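/- **Conventions.** A *weak composition* $\alpha=(\alpha_1,\dots,\alpha_k)$ of $n$ (written $\alpha\models n$) is a finite sequence of nonnegative integers with sum $n$, taken modulo trailing zeros; put $n(\alpha):=\sum_i\binom{\alpha_i}{2}$. A partition $\lambda\vdash n$ is a weakly decreasing weak composition. For $q>0$ put $[m]_q:=1+q+\cdots+q^{m-1}$, $[m]_q!:=[m]_q\cdots[1]_q$ and $\binom{m}{k}_q:=\frac{[m]_q!}{[k]_q!\,[m-k]_q!}$. Let $\mathrm{SSYT}(\lambda)$ be the set of semistandard Young tableaux of shape $\lambda$ with entries in $\mathbb{Z}_{>0}$, and $\mathrm{SSYT}(\lambda,\alpha)$ the subset of those of content $\alpha$ (exactly $\alpha_i$ entries equal to $i$). For $T\in\mathrm{SSYT}(\lambda)$ let $T^{(j)}$ be the partition formed by the boxes of $T$ with entries at most $j$, and set $$\mathrm{wt}_q(T):=\prod_{i,j\ge 1}\binom{T^{(j)}_i-T^{(j)}_{i+1}}{T^{(j)}_i-T^{(j-1)}_i}_q,\qquad W_\lambda(\mathbf{x};q):=\sum_{T\in\mathrm{SSYT}(\lambda)}\mathrm{wt}_q(T)\prod_{i\ge1}x_i^{\#\{i\text{'s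 in }T\}},$$ a formal power series in $\mathbf{x}=(x_1,x_2,\dots)$. For a nilpotent endomorphism $N$ of a finite-dimensional vector space, $\mathrm{JF}(N)$ denotes the conjugate of the partition formed by the sizes of the Jordan blocks of $N$. For $\alpha=(\alpha_1,\dots,\alpha_k)\models n$, let $\mathrm{Fl}_\alpha$ be the set of partial flags $F: 0=F_0\subseteq F_1\subseteq\cdots\subseteq F_k=\Bbbk^n$ with $\dim F_i=\alpha_1+\cdots+\alpha_i$ for all $i$; partial flags are taken modulo repetitions of $\Bbbk^n$ at the end. $F$ is *strictly compatible* with $N$ if $N(F_i)\subseteq F_{i-1}$ for all $i\ge 1$; in that case $\mathrm{JF}(N;F)$ is the semistandard tableau $T$ with $T^{(i)}=\mathrm{JF}(N|_{F_i})$ for all $i$. **Theorem.** Let $q$ be such that $1/q$ is a prime power, and let $\Bbbk:=\mathbb{F}_{1/q}$ be the field with $1/q$ elements. Let $\lambda\vdash n$, and let $N$ be a nilpotent endomorphism of $\Bbbk^n$ with $\mathrm{JF}(N)=\lambda$. (i) For all $\alpha\models n$ and $T\in\mathrm{SSYT}(\lambda,\alpha)$, $$\mathrm{wt}_q(T)=q^{n(\lambda)-n(\alpha)}\,\bigl|\{F\in\mathrm{Fl}_\alpha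 : F\text{ is strictly compatible with }N\text{ and }\mathrm{JF}(N;F)=T\}\bigr|.$$ (ii) For all $\alpha\models n$, the coefficient of $\mathbf{x}^\alpha=\prod_i x_i^{\alpha_i}$ in $W_\lambda(\mathbf{x};q)$ is $$[\mathbf{x}^\alpha]W_\lambda(\mathbf{x};q)=q^{n(\lambda)-n(\alpha)}\,\bigl|\{F\in\mathrm{Fl}_\alpha : F\text{ is strictly compatible with }N\}\bigr|.$$ (iii) We have $$W_\lambda(\mathbf{x};q)=q^{n(\lambda)}\sum_F\prod_{i\ge1}q^{-\binom{\dim(F_i/F_{i-1})}{2}}x_i^{\dim(F_i/F_{i-1})},$$ where the (convergent) formal sum is over all partial flags $F$ of $\Bbbk^n$ that are strictly compatible with $N$. -/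

import Mathlib

open scoped MvPowerSeries.WithPiTopology

noncomputable section

namespace QWhittaker

/-! Positive integers `1, 2, 3, …` indexing tableau letters, variables `x₁, x₂, …`, parts of weak
compositions and rows of partitions are represented by the natural numbers `0, 1, 2, …`. In
particular the letter `i` of a tableau is represented by the entry `i - 1`. A weak composition
(a finite sequence of natural numbers modulo trailing zeros) is a finitely supported function
`ℕ →₀ ℕ`, and a partition is a Young diagram. -/

/-! ### The statistic `n(·)` -/

/-- `n(α) = ∑ᵢ (αᵢ choose 2)` for a weak composition `α`. -/
def nComp (α : ℕ →₀ ℕ) : ℕ := α.sum fun _ a => a.choose 2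

/-- `n(μ) = ∑ᵢ (μᵢ choose 2)` for a partition `μ`, where `μᵢ` are the row lengths. -/
def nPart (μ : YoungDiagram) : ℕ := ∑ i ∈ Finset.range (μ.colLen 0), (μ.rowLen i).choose 2

/-! ### Semistandard tableaux -/

/-- The partition formed by the first `j` letters of a semistandard tableau. -/
def upTo {μ : YoungDiagram} (T : SemistandardYoungTableau μ) (j : ℕ) : YoungDiagram where
  cells := μ.cells.filter fun c => T c.1 c.2 < j
  isLowerSet := by
    rintro ⟨a, b⟩ ⟨c, d⟩ h hab
    simp only [Finset.coe_filter, Set.mem_ofPred_eq, YoungDiagram.mem_cells] at hab ⊢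
    obtain ⟨h1, h2⟩ := Prod.mk_le_mk.1 h
    refine ⟨μ.up_left_mem h1 h2 hab.1, lt_of_le_of_lt ?_ hab.2⟩
    exact (T.row_weak_of_le h2 (μ.up_left_mem h1 le_rfl hab.1)).trans (T.col_weak h1 hab.1)

/-- The content of a tableau: the multiplicity of each letter. -/
def content {μ : YoungDiagram} (T : SemistandardYoungTableau μ) : ℕ →₀ ℕ :=
  ∑ c ∈ μ.cells, Finsupp.single (T c.1 c.2) 1

/-- The set `SSYT(μ, α)` of semistandard tableaux of shape `μ` and content `α`. -/
def SSYT (μ : YoungDiagram) (α : ℕ →₀ ℕ) : Set (SemistandardYoungTableau μ) :=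
  {T | content T = α}

theorem finite_SSYT (μ : YoungDiagram) (α : ℕ →₀ ℕ) : (SSYT μ α).Finite := by
  have key : ∀ T ∈ SSYT μ α, ∀ c : μ.cells, T c.1.1 c.1.2 ∈ α.support := by
    rintro T rfl c
    rw [Finsupp.mem_support_iff, content, Finsupp.finsetSum_apply]
    refine (Finset.sum_pos' (fun _ _ => Nat.zero_le _) ⟨c.1, c.2, ?_⟩).ne'
    simp
  refine Set.Finite.of_injOn (f := fun T (c : μ.cells) => T c.1.1 c.1.2)
    (t := Set.pi Set.univ fun _ => (α.support : Set ℕ)) ?_ ?_ ?_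
  · intro T hT c _
    exact key T hT c
  · intro T _ T' _ h
    ext i j
    by_cases hc : (i, j) ∈ μ
    · exact congrFun h ⟨(i, j), (YoungDiagram.mem_cells _).2 hc⟩
    · rw [T.zeros hc, T'.zeros hc]
  · exact Set.Finite.pi fun _ => Finset.finite_toSet _

/-! ### `q`-analogues -/

/-- The `q`-number `1 + q + ⋯ + q^(n-1)`. -/
def qNum (q : ℝ) (n : ℕ) : ℝ := ∑ i ∈ Finset.range n, q ^ i

/-- The `q`-factorial `[n]_q [n-1]_q ⋯ [1]_q`. -/
def qFact (q : ℝ) (n : ℕ) : ℝ := ∏ i ∈ Finset.range n, qNum q (i + 1)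

/-- The `q`-binomial coefficient, for `k ≤ n`. -/
def qBinom (q : ℝ) (n k : ℕ) : ℝ := qFact q n / (qFact q k * qFact q (n - k))

/-! ### `q`-Whittaker functions -/

/-- The factor of the `q`-weight at row `i` and letter `j` (both counted from `0`). -/
def wtFactor (q : ℝ) {μ : YoungDiagram} (T : SemistandardYoungTableau μ) (i j : ℕ) : ℝ :=
  qBinom q ((upTo T (j + 1)).rowLen i - (upTo T (j + 1)).rowLen (i + 1))
    ((upTo T (j + 1)).rowLen i - (upTo T j).rowLen i)

/-- The `q`-weight of a semistandard tableau, the product of its factors over all rows and letters;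
all but finitely many factors are `1` when `q > 0`, see `finite_mulSupport_wtFactor`. -/
def wt (q : ℝ) {μ : YoungDiagram} (T : SemistandardYoungTableau μ) : ℝ :=
  ∏ᶠ p : ℕ × ℕ, wtFactor q T p.1 p.2

/-- The `q`-Whittaker function `∑_T wt_q(T) x^T`, the formal sum running over all semistandard
tableaux `T` of shape `μ`: its coefficient at `x^α` is the finite sum of `wt_q(T)` over those `T`
that have content `α`. -/
def whittaker (q : ℝ) (μ : YoungDiagram) : MvPowerSeries ℕ ℝ :=
  fun α => ∑ᶠ T ∈ SSYT μ α, wt q T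

theorem hasSum_whittaker (q : ℝ) (μ : YoungDiagram) :
    HasSum (fun T : SemistandardYoungTableau μ => MvPowerSeries.monomial (content T) (wt q T))
      (whittaker q μ) := by
  classical
  refine (MvPowerSeries.WithPiTopology.tendsto_iff_coeff_tendsto _ _ _).2 fun α => ?_
  have h := hasSum_sum_of_ne_finset_zero (L := SummationFilter.unconditional _)
    (s := (finite_SSYT μ α).toFinset)
    (f := fun T => MvPowerSeries.coeff α (MvPowerSeries.monomial (content T) (wt q T)))
    (fun T hT => by
      rw [MvPowerSeries.coeff_monomial, if_neg]
      rintro rfl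
      exact hT ((Set.Finite.mem_toFinset _).2 rfl))
  have h2 : MvPowerSeries.coeff α (whittaker q μ) = ∑ T ∈ (finite_SSYT μ α).toFinset,
      MvPowerSeries.coeff α (MvPowerSeries.monomial (content T) (wt q T)) := by
    refine (finsum_mem_eq_finite_toFinset_sum _ (finite_SSYT μ α)).trans ?_
    refine Finset.sum_congr rfl fun T hT => ?_
    have hc : content T = α := (Set.Finite.mem_toFinset (finite_SSYT μ α)).1 hT
    rw [MvPowerSeries.coeff_monomial, if_pos hc.symm]
  rw [h2]
  simpa only [HasSum, map_sum] using h

/-! ### Jordan forms -/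

section Jordan

variable {K : Type*} [Field K] {V : Type*} [AddCommGroup V] [Module K V]

/-- The block diagonal matrix `J_ν` with one Jordan block of eigenvalue `0` (ones on the
superdiagonal) of size `ν_i` for each row `i` of `ν`. The basis vectors are indexed by the boxes of
`ν`, the boxes of row `i` (from left to right) belonging to the `i`-th block. -/
def jordanMatrix (K : Type*) [Field K] (ν : YoungDiagram) : Matrix ν.cells ν.cells K :=
  Matrix.of fun a b => if a.1.1 = b.1.1 ∧ a.1.2 + 1 = b.1.2 then 1 else 0

/-- `JF(N) = μ`: the conjugated Jordan form partition of `N` is `μ`, i.e. `N` is represented by the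
Jordan matrix of the conjugate partition of `μ` with respect to some basis. -/
def IsJF (N : Module.End K V) (μ : YoungDiagram) : Prop :=
  ∃ b : Module.Basis μ.transpose.cells K V,
    LinearMap.toMatrix b b N = jordanMatrix K μ.transpose

end Jordan

/-! ### Partial flags -/

section Flags

variable {K : Type*} [Field K] {n : ℕ}

/-- A partial flag `0 = F₀ ⊆ F₁ ⊆ ⋯ ⊆ F_k = Kⁿ`, continued by `F_i = Kⁿ` for `i > k`. Thus flags
which differ only by repetitions of the last space are identified, just as weak compositions which
differ only by trailing zeros. -/
structure PartialFlag (K : Type*) [Field K] (n : ℕ) where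
  space : ℕ → Submodule K (Fin n → K)
  mono : Monotone space
  zero : space 0 = ⊥
  exhaustive : ∃ k, space k = ⊤

/-- The weak composition of `n` formed by the dimensions of `F_{i+1} / F_i`. -/
def PartialFlag.type (F : PartialFlag K n) : ℕ →₀ ℕ :=
  Finsupp.ofSupportFinite
    (fun i => Module.finrank K (F.space (i + 1)) - Module.finrank K (F.space i)) <| by
    obtain ⟨k, hk⟩ := F.exhaustive
    refine (Set.finite_lt_nat k).subset fun i hi => ?_
    by_contra h
    have h1 : k ≤ i := not_lt.1 h
    have h2 : F.space i = ⊤ := top_le_iff.1 (hk ▸ F.mono h1)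
    have h3 : F.space (i + 1) = ⊤ := top_le_iff.1 (hk ▸ F.mono (h1.trans i.le_succ))
    exact hi (Nat.sub_eq_zero_of_le (Submodule.finrank_mono (h3.trans h2.symm).le))

/-- The partial flag variety `Fl_α`, for a weak composition `α` of `n`. -/
def Fl (K : Type*) [Field K] (n : ℕ) (α : ℕ →₀ ℕ) : Set (PartialFlag K n) :=
  {F | ∀ i, Module.finrank K (F.space i) = ∑ j ∈ Finset.range i, α j}

/-- `F` and `N` are strictly compatible: `N(F_i) ⊆ F_{i-1}` for all `i ≥ 1`. -/
def StrictlyCompatible (F : PartialFlag K n) (N : Module.End K (Fin n → K)) : Prop :=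
  ∀ i, (F.space (i + 1)).map N ≤ F.space i

theorem StrictlyCompatible.mapsTo {F : PartialFlag K n} {N : Module.End K (Fin n → K)}
    (h : StrictlyCompatible F N) (i : ℕ) : ∀ x ∈ F.space i, N x ∈ F.space i := fun _ hx =>
  h i (Submodule.mem_map_of_mem (F.mono i.le_succ hx))

/-- `JF(N; F) = T`, for `F` strictly compatible with `N`: for every `i`, the partition formed by the
first `i` letters of `T` is the conjugated Jordan form partition of the restriction of `N`
to `F_i`. -/
def IsJFTableau {F : PartialFlag K n} {N : Module.End K (Fin n → K)} (h : StrictlyCompatible F N)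
    {μ : YoungDiagram} (T : SemistandardYoungTableau μ) : Prop :=
  ∀ i, IsJF (N.restrict (h.mapsTo i)) (upTo T i)

end Flags

theorem finite_mulSupport_wtFactor {q : ℝ} (hq : 0 < q) {μ : YoungDiagram}
    (T : SemistandardYoungTableau μ) :
    (Function.mulSupport fun p : ℕ × ℕ => wtFactor q T p.1 p.2).Finite := by
  have hnum : ∀ m, qNum q (m + 1) ≠ 0 := fun m =>
    (Finset.sum_pos (fun i _ => pow_pos hq i) (by simp)).ne'
  have hfact : ∀ m, qFact q m ≠ 0 := fun m => Finset.prod_ne_zero_iff.2 fun i _ => hnum i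
  have hone : ∀ m, qBinom q m 0 = 1 := fun m => by
    have : qFact q 0 = 1 := by simp [qFact]
    rw [qBinom, this, one_mul, Nat.sub_zero, div_self (hfact m)]
  refine (μ.cells.image fun c => (c.1, T c.1 c.2)).finite_toSet.subset ?_
  rintro ⟨i, j⟩ hij
  by_contra hno
  apply hij
  have hle : (upTo T (j + 1)).rowLen i ≤ (upTo T j).rowLen i := by
    by_contra hlt
    have h1 := YoungDiagram.mem_iff_lt_rowLen.2 (not_le.1 hlt)
    have h2 : (i, (upTo T j).rowLen i) ∉ upTo T j := fun h =>
      lt_irrefl _ (YoungDiagram.mem_iff_lt_rowLen.1 h)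
    rw [← YoungDiagram.mem_cells] at h1 h2
    simp only [upTo, Finset.mem_filter, not_and, not_lt] at h1 h2
    refine hno ?_
    simp only [Finset.coe_image, Set.mem_image]
    exact ⟨_, h1.1, Prod.ext rfl (le_antisymm (Nat.lt_succ_iff.1 h1.2) (h2 h1.1))⟩
  simp only [wtFactor, Nat.sub_eq_zero_of_le hle, hone]

end QWhittaker

end

namespace QWhittaker

open Module Submodule

/-! ### Counting by fibres -/

/-! The Jordan type of `N` on an invariant subspace `W` is equivalent to the list of dimensions of
`W ⊓ ker (N ^ i)`, whose increments are the rows of the conjugated partition (`isJF_restrict_iff`).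
Hence a strictly compatible flag with tableau `T` is a chain of subspaces of types `upTo T 0`, `upTo
T 1`, …, and it can be counted by peeling off spaces from the top.

One step asks for the number of `W'` of type `m` with `N W ≤ W' ≤ W`, where `W` has type `l`.
Consider the filtration `A i = N W + (W ⊓ ker (N ^ i))` from `N W` to `W`. Its successive quotients
have dimensions `l_i - l_{i+1}`, and by the modular law `W'` has type `m` exactly when it meets
these quotients in dimensions `m_i - l_{i+1}`. Subspaces in prescribed position to a filtration are
counted by Gaussian binomials at `1/q` times powers of `1/q`; rewritten at `q` they give `∏ qBinom
(l_i - l_{i+1}) (l_i - m_i)` and one power of `q` (`ncard_subspaces_filtration`). The identity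
`sum_choose_two_of_interlacing` shows that its exponent is `n(l) - n(m) - (|l| - |m| choose 2)`
(`KerDims.ncard_mul_pow`).

The count depends on `W` only through its type, so the steps multiply. The terms `n(·)` telescope to
`n(μ)`, the binomials of the box numbers add up to `n(α)`, and the products form `wt q T`
(`ncard_chains_mul_pow`), which is (i). The types along a strictly compatible flag interlace, so
each flag has exactly one tableau (`exists_isJFTableau`, `IsJFTableau.unique`); summing over `T`
gives (ii), and collecting all coefficients gives (iii). -/

theorem ncard_eq_sum_fiber {α β : Type*} {s : Set α} {t : Set β} (hs : s.Finite) (ht : t.Finite)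
    (f : α → β) (hf : ∀ a ∈ s, f a ∈ t) :
    s.ncard = ∑ b ∈ ht.toFinset, {a ∈ s | f a = b}.ncard := by
  classical
  rw [Set.ncard_eq_toFinset_card s hs,
    Finset.card_eq_sum_card_fiberwise (f := f) (t := ht.toFinset)
      (fun a ha => by simpa using hf a (by simpa using ha))]
  refine Finset.sum_congr rfl fun b _ => ?_
  rw [← Set.ncard_coe_finset]
  congr 1
  ext a
  simp

theorem ncard_eq_mul_of_fiber {α β : Type*} {s : Set α} {t : Set β} (hs : s.Finite)
    (ht : t.Finite) (f : α → β) (hf : ∀ a ∈ s, f a ∈ t) {m : ℕ}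
    (h : ∀ b ∈ t, {a ∈ s | f a = b}.ncard = m) : s.ncard = t.ncard * m := by
  rw [ncard_eq_sum_fiber hs ht f hf,
    Finset.sum_congr rfl fun b hb => h b ((Set.Finite.mem_toFinset ht).1 hb), Finset.sum_const,
    smul_eq_mul, ← Set.ncard_eq_toFinset_card t ht]

/-! ### Counting subspaces -/

section Counting

variable {K : Type*} [Field K] [Finite K]

/-- A linear section of `f` splits a tuple into an arbitrary tuple in the kernel and its image, an
independent tuple in `F`. -/
theorem card_linearIndependent_comp {E F : Type*} [AddCommGroup E] [Module K E]
    [AddCommGroup F] [Module K F] [Module.Finite K F] (f : E →ₗ[K] F)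
    (hf : Function.Surjective f) {w : ℕ} (hw : w ≤ finrank K F) :
    Nat.card {v : Fin w → E // LinearIndependent K (f ∘ v)} =
      Nat.card (LinearMap.ker f) ^ w *
        ∏ i ∈ Finset.range w, (Nat.card K ^ finrank K F - Nat.card K ^ i) := by
  have := Fintype.ofFinite K
  have : Finite F := Module.finite_of_finite K
  obtain ⟨g, hg⟩ := f.exists_rightInverse_of_surjective (LinearMap.range_eq_top.2 hf)
  have hg' : ∀ x, f (g x) = x := fun x => by
    simpa using LinearMap.congr_fun hg x
  let e : {v : Fin w → E // LinearIndependent K (f ∘ v)} ≃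
      (Fin w → LinearMap.ker f) × {v : Fin w → F // LinearIndependent K v} :=
    { toFun := fun v => (fun i => ⟨v.1 i - g (f (v.1 i)), by simp [hg']⟩, ⟨f ∘ v.1, v.2⟩)
      invFun := fun p => ⟨fun i => (p.1 i : E) + g (p.2.1 i), by
        have : f ∘ (fun i => (p.1 i : E) + g (p.2.1 i)) = p.2.1 := by
          ext i
          simp [hg']
        rw [this]
        exact p.2.2⟩
      left_inv := fun v => by
        ext i
        simp
      right_inv := fun p => by
        refine Prod.ext ?_ ?_
        · funext i
          ext
          simp [hg']
        · ext i
          simp [hg'] }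
  rw [Nat.card_congr e, Nat.card_prod, Nat.card_pi, card_linearIndependent hw,
    Finset.prod_range, Nat.card_eq_fintype_card (α := K)]
  simp

variable {V : Type*} [AddCommGroup V] [Module K V] [Module.Finite K V]

theorem ncard_linearIndependent_mod {A C : Submodule K V} (hCA : C ≤ A) {w : ℕ}
    (hw : finrank K C + w ≤ finrank K A) :
    {v : Fin w → V | (∀ i, v i ∈ A) ∧ LinearIndependent K (C.mkQ ∘ v)}.ncard =
      Nat.card K ^ (finrank K C * w) *
        ∏ i ∈ Finset.range w, (Nat.card K ^ (finrank K A - finrank K C) - Nat.card K ^ i) := by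
  let f := (C.mkQ.comp A.subtype).rangeRestrict
  have hker : LinearMap.ker f = C.comap A.subtype := by
    rw [LinearMap.ker_rangeRestrict, LinearMap.ker_comp, ker_mkQ]
  have hkd : finrank K (LinearMap.ker f) = finrank K C := by
    rw [hker, ← finrank_map_subtype_eq A, Submodule.map_comap_subtype, inf_eq_right.2 hCA]
  have hrd : finrank K (LinearMap.range (C.mkQ.comp A.subtype)) = finrank K A - finrank K C := by
    have h1 := (C.mkQ.comp A.subtype).finrank_range_add_finrank_ker
    rw [LinearMap.ker_rangeRestrict] at hkd
    omega
  have key := card_linearIndependent_comp f (LinearMap.surjective_rangeRestrict _) (w := w)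
    (by omega)
  rw [Module.natCard_eq_pow_finrank (K := K) (V := LinearMap.ker f), hkd, hrd, ← pow_mul] at key
  rw [← key, ← Nat.card_coe_set_eq]
  have hli : ∀ v : Fin w → A, LinearIndependent K (f ∘ v) ↔
      LinearIndependent K (C.mkQ ∘ fun i => (v i : V)) := fun v => by
    rw [← LinearMap.linearIndependent_iff (LinearMap.range (C.mkQ.comp A.subtype)).subtype
      (ker_subtype _)]
    rfl
  exact Nat.card_congr
    { toFun := fun v => ⟨fun i => ⟨v.1 i, v.2.1 i⟩, (hli _).2 v.2.2⟩
      invFun := fun v => ⟨fun i => v.1 i, fun i => (v.1 i).2, (hli _).1 v.2⟩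
      left_inv := fun v => rfl
      right_inv := fun v => rfl }

/-- Double counting through `v ↦ D ⊔ span v`, for tuples `v` in `A` independent modulo `C`. Since `W
⊓ C = D`, a tuple in `W` is independent modulo `C` as soon as it is independent modulo `D`, so all
fibres have the same size. -/
theorem ncard_subspaces_inf_eq_mul {A C D : Submodule K V} (hDC : D ≤ C) (hCA : C ≤ A) {w : ℕ}
    (hw : finrank K C + w ≤ finrank K A) :
    {W : Submodule K V | W ≤ A ∧ W ⊓ C = D ∧ finrank K W = finrank K D + w}.ncard *
        (Nat.card K ^ (finrank K D * w) *
          ∏ i ∈ Finset.range w, (Nat.card K ^ w - Nat.card K ^ i)) =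
      Nat.card K ^ (finrank K C * w) *
        ∏ i ∈ Finset.range w, (Nat.card K ^ (finrank K A - finrank K C) - Nat.card K ^ i) := by
  have : Finite V := Module.finite_of_finite K
  rw [← ncard_linearIndependent_mod hCA hw]
  refine (ncard_eq_mul_of_fiber (Set.toFinite _) (Set.toFinite _)
    (fun v => D ⊔ span K (Set.range v)) ?_ ?_).symm
  · rintro v ⟨hvA, hv⟩
    have hd : Disjoint (span K (Set.range v)) C := by
      simpa using range_ker_disjoint hv
    refine ⟨sup_le (hDC.trans hCA) (span_le.2 (by rintro _ ⟨i, rfl⟩; exact hvA i)), ?_, ?_⟩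
    · rw [sup_inf_assoc_of_le _ hDC, hd.eq_bot, sup_bot_eq]
    · have h := finrank_sup_add_finrank_inf_eq D (span K (Set.range v))
      rw [(hd.mono_right hDC).symm.eq_bot, finrank_bot, add_zero,
        finrank_span_eq_card (hv.of_comp), Fintype.card_fin] at h
      exact h
  · rintro W ⟨hWA, hWC, hWd⟩
    have hDW : D ≤ W := hWC ▸ inf_le_left
    have := ncard_linearIndependent_mod hDW hWd.ge
    rw [hWd, Nat.add_sub_cancel_left] at this
    rw [← this]
    congr 1
    ext v
    constructor
    · rintro ⟨⟨-, hv⟩, rfl⟩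
      have hd : Disjoint (span K (Set.range v)) C := by
        simpa using range_ker_disjoint hv
      refine ⟨fun i => mem_sup_right (subset_span ⟨i, rfl⟩), ?_⟩
      rw [LinearMap.linearIndependent_iff_of_disjoint]
      · exact hv.of_comp
      · rw [ker_mkQ]
        exact hd.mono_right hDC
    · rintro ⟨hvW, hv⟩
      have hd : Disjoint (span K (Set.range v)) D := by
        simpa using range_ker_disjoint hv
      have hvW' : span K (Set.range v) ≤ W := span_le.2 (by rintro _ ⟨i, rfl⟩; exact hvW i)
      refine ⟨⟨fun i => hWA (hvW i), ?_⟩, ?_⟩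
      · rw [LinearMap.linearIndependent_iff_of_disjoint]
        · exact hv.of_comp
        · rw [ker_mkQ, disjoint_iff_inf_le, ← hd.eq_bot]
          exact le_inf inf_le_left ((inf_le_inf_right _ hvW').trans hWC.le)
      · refine Submodule.eq_of_le_of_finrank_eq (sup_le hDW hvW') ?_
        have h := finrank_sup_add_finrank_inf_eq D (span K (Set.range v))
        rw [hd.symm.eq_bot, finrank_bot, add_zero,
          finrank_span_eq_card (hv.of_comp), Fintype.card_fin] at h
        rw [h, hWd]

end Counting

/-! ### `q`-binomial coefficients -/

theorem one_sub_pow_mul_qFact (q : ℝ) (m : ℕ) :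
    (1 - q) ^ m * qFact q m = ∏ i ∈ Finset.range m, (1 - q ^ (i + 1)) := by
  rw [qFact, ← Finset.card_range m, ← Finset.prod_const, Finset.card_range,
    ← Finset.prod_mul_distrib]
  exact Finset.prod_congr rfl fun i _ => by rw [qNum, mul_neg_geom_sum]

theorem qFact_pos {q : ℝ} (hq : 0 < q) (m : ℕ) : 0 < qFact q m :=
  Finset.prod_pos fun i _ => Finset.sum_pos (fun _ _ => pow_pos hq _) (by simp)

theorem qBinom_zero_right {q : ℝ} (hq : 0 < q) (m : ℕ) : qBinom q m 0 = 1 := by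
  have : qFact q 0 = 1 := by simp [qFact]
  rw [qBinom, this, one_mul, Nat.sub_zero, div_self (qFact_pos hq m).ne']

theorem qBinom_symm (q : ℝ) {m k : ℕ} (h : k ≤ m) : qBinom q m (m - k) = qBinom q m k := by
  rw [qBinom, qBinom, Nat.sub_sub_self h, mul_comm]

/-- `q^(uw) ∏_{i<w} (q^(-u) - q^(-i))` in terms of `q`-factorials. -/
theorem pow_mul_prod_inv_pow_sub {q : ℝ} (hq : 0 < q) {u w : ℕ} (h : w ≤ u) :
    q ^ (u * w) * (∏ i ∈ Finset.range w, (q⁻¹ ^ u - q⁻¹ ^ i)) * qFact q (u - w) =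
      (1 - q) ^ w * qFact q u := by
  -- At `q = 1` the power of `1 - q` cancelled below may vanish; there both sides are zero unless `w
  -- = 0`.
  rcases eq_or_ne q 1 with rfl | hq1
  · rcases w with _ | w
    · simp
    · simp
  have h1 : q ^ (u * w) * (∏ i ∈ Finset.range w, (q⁻¹ ^ u - q⁻¹ ^ i)) =
      ∏ i ∈ Finset.range w, (1 - q ^ (u - i)) := by
    rw [pow_mul, ← Finset.card_range w, ← Finset.prod_const, Finset.card_range,
      ← Finset.prod_mul_distrib]
    refine Finset.prod_congr rfl fun i hi => ?_
    have hi' : i ≤ u := ((Finset.mem_range.1 hi).trans_le h).le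
    rw [mul_sub, ← mul_pow, mul_inv_cancel₀ hq.ne', one_pow, pow_sub₀ _ hq.ne' hi', inv_pow]
  have h2 : (∏ i ∈ Finset.range w, (1 - q ^ (u - i))) *
      (∏ i ∈ Finset.range (u - w), (1 - q ^ (i + 1))) =
        ∏ i ∈ Finset.range u, (1 - q ^ (i + 1)) := by
    rw [← Finset.prod_range_reflect _ u, ← Finset.prod_range_reflect _ (u - w)]
    have : u = w + (u - w) := by omega
    conv_rhs => rw [this, Finset.prod_range_add]
    congr 1
    · refine Finset.prod_congr rfl fun i hi => ?_
      have := Finset.mem_range.1 hi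
      congr 2
      omega
    · refine Finset.prod_congr rfl fun i hi => ?_
      have := Finset.mem_range.1 hi
      congr 2
      omega
  have h3 : (1 - q) ^ (u - w) ≠ 0 := pow_ne_zero _ (sub_ne_zero.2 (Ne.symm hq1))
  refine mul_left_cancel₀ h3 ?_
  rw [h1, mul_left_comm, one_sub_pow_mul_qFact, h2, ← mul_assoc, ← pow_add,
    Nat.sub_add_cancel h, one_sub_pow_mul_qFact]

/-! ### Subspace counts as `q`-binomial coefficients -/

section Counting

variable {K : Type*} [Field K] [Finite K] {V : Type*} [AddCommGroup V] [Module K V]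
  [Module.Finite K V]

theorem lt_one_of_inv_eq_card {q : ℝ} (hq : q⁻¹ = (Nat.card K : ℝ)) : 0 < q ∧ q < 1 := by
  have h1 : (1 : ℝ) < q⁻¹ := by
    rw [hq]
    exact_mod_cast Finite.one_lt_card
  exact (one_lt_inv_iff₀.1 h1)

/-- In the exponent, `w * e` comes from lifting a `w`-dimensional subspace of `A / C` to `A / D`,
and `w * (u - w)` from passing from the Gaussian binomial at `1/q` to the one at `q`. -/
theorem ncard_subspaces_inf_eq {q : ℝ} (hq : q⁻¹ = (Nat.card K : ℝ)) {A C D : Submodule K V}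
    (hDC : D ≤ C) (hCA : C ≤ A) {w u e : ℕ} (hu : finrank K A = finrank K C + u) (hw : w ≤ u)
    (he : finrank K C = finrank K D + e) :
    ({W : Submodule K V | W ≤ A ∧ W ⊓ C = D ∧ finrank K W = finrank K D + w}.ncard : ℝ) *
      q ^ (w * (e + (u - w))) = qBinom q u w := by
  obtain ⟨hq0, hq1⟩ := lt_one_of_inv_eq_card hq
  have key := ncard_subspaces_inf_eq_mul hDC hCA (w := w) (by omega)
  rw [show finrank K A - finrank K C = u by omega] at key
  have hcast : ∀ m, w ≤ m → ((∏ i ∈ Finset.range w, (Nat.card K ^ m - Nat.card K ^ i) : ℕ) : ℝ) =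
      ∏ i ∈ Finset.range w, (q⁻¹ ^ m - q⁻¹ ^ i) := fun m hm => by
    rw [Nat.cast_prod]
    refine Finset.prod_congr rfl fun i hi => ?_
    have hi' := Finset.mem_range.1 hi
    rw [Nat.cast_sub (Nat.pow_le_pow_right Nat.card_pos (by omega)), hq]
    push_cast
    rfl
  have key' := congrArg (Nat.cast : ℕ → ℝ) key
  rw [Nat.cast_mul, Nat.cast_mul, Nat.cast_mul, hcast w le_rfl, hcast u hw, he] at key'
  push_cast at key'
  rw [← hq] at key'
  have hU := pow_mul_prod_inv_pow_sub hq0 hw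
  have hW := pow_mul_prod_inv_pow_sub hq0 (le_refl w)
  rw [Nat.sub_self, show qFact q 0 = 1 by simp [qFact], mul_one] at hW
  set c : ℝ := (({W : Submodule K V | W ≤ A ∧ W ⊓ C = D ∧
    finrank K W = finrank K D + w}.ncard : ℕ) : ℝ)
  set PU := ∏ i ∈ Finset.range w, (q⁻¹ ^ u - q⁻¹ ^ i)
  set PW := ∏ i ∈ Finset.range w, (q⁻¹ ^ w - q⁻¹ ^ i)
  have hqw : (1 - q) ^ w ≠ 0 := pow_ne_zero _ (by linarith)
  have h1 : c * PW = q⁻¹ ^ (e * w) * PU := by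
    rw [add_mul, pow_add] at key'
    refine mul_left_cancel₀ (pow_ne_zero (finrank K D * w) (inv_ne_zero hq0.ne')) ?_
    linear_combination key'
  have h2 : q ^ (e * w) * q⁻¹ ^ (e * w) = 1 := by
    rw [← mul_pow, mul_inv_cancel₀ hq0.ne', one_pow]
  rw [qBinom, eq_div_iff (mul_ne_zero (qFact_pos hq0 _).ne' (qFact_pos hq0 _).ne')]
  refine mul_left_cancel₀ hqw ?_
  rw [← hU]
  have h3 : q ^ (w * (e + (u - w))) * q ^ (w * w) = q ^ (e * w) * q ^ (u * w) := by
    rw [← pow_add, ← pow_add]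
    congr 1
    obtain ⟨k, rfl⟩ := Nat.exists_eq_add_of_le hw
    rw [Nat.add_sub_cancel_left]
    ring
  calc (1 - q) ^ w * (c * q ^ (w * (e + (u - w))) * (qFact q w * qFact q (u - w)))
      = c * q ^ (w * (e + (u - w))) * ((1 - q) ^ w * qFact q w) * qFact q (u - w) := by ring
    _ = c * PW * (q ^ (w * (e + (u - w))) * q ^ (w * w)) * qFact q (u - w) := by
        rw [← hW]; ring
    _ = (q ^ (e * w) * q⁻¹ ^ (e * w)) * (q ^ (u * w) * PU * qFact q (u - w)) := by
        rw [h1, h3]; ring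
    _ = _ := by rw [h2, one_mul]

/-- The subspaces between the first and the last member of a filtration which meet its members in
prescribed dimensions. -/
theorem ncard_subspaces_filtration {q : ℝ} (hq : q⁻¹ = (Nat.card K : ℝ)) {A : ℕ → Submodule K V}
    (hA : Monotone A) {f c : ℕ → ℕ} (h0 : f 0 = finrank K (A 0))
    (hf : Monotone f) (hc : ∀ i, finrank K (A i) = f i + c i) (hcm : Monotone c) (r : ℕ) :
    ({W : Submodule K V | A 0 ≤ W ∧ W ≤ A r ∧
        ∀ i ≤ r, finrank K ((W ⊓ A i : Submodule K V)) = f i}.ncard : ℝ) *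
      q ^ (∑ i ∈ Finset.range r, (f (i + 1) - f i) * c (i + 1)) =
      ∏ i ∈ Finset.range r,
        qBinom q (finrank K (A (i + 1)) - finrank K (A i)) (f (i + 1) - f i) := by
  have : Finite V := Module.finite_of_finite K
  have : Finite (Submodule K V) := inferInstance
  induction r with
  | zero =>
    have : {W : Submodule K V | A 0 ≤ W ∧ W ≤ A 0 ∧
        ∀ i ≤ 0, finrank K ((W ⊓ A i : Submodule K V)) = f i} = {A 0} := by
      ext W
      simp only [Set.mem_ofPred_eq, Set.mem_singleton_iff]
      constructor
      · rintro ⟨h1, h2, -⟩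
        exact le_antisymm h2 h1
      · rintro rfl
        refine ⟨le_rfl, le_rfl, fun i hi => ?_⟩
        obtain rfl : i = 0 := by omega
        rw [inf_idem, h0]
    rw [this]
    simp
  | succ r ih =>
    rw [Finset.prod_range_succ, ← ih, Finset.sum_range_succ, pow_add]
    have hcr := hc r
    have hcr' := hc (r + 1)
    have hfr : f r ≤ f (r + 1) := hf r.le_succ
    have hcmr : c r ≤ c (r + 1) := hcm r.le_succ
    have hArr : A r ≤ A (r + 1) := hA r.le_succ
    set S := {W : Submodule K V | A 0 ≤ W ∧ W ≤ A r ∧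
        ∀ i ≤ r, finrank K ((W ⊓ A i : Submodule K V)) = f i} with hS
    -- The sets are fibred over `D = W ⊓ A r`: the conditions at all lower members of the filtration
    -- depend on `D` only.
    have hfib : ∀ D ∈ S, {W ∈ {W : Submodule K V | A 0 ≤ W ∧ W ≤ A (r + 1) ∧
        ∀ i ≤ r + 1, finrank K ((W ⊓ A i : Submodule K V)) = f i} | W ⊓ A r = D} =
        {W : Submodule K V | W ≤ A (r + 1) ∧ W ⊓ A r = D ∧
          finrank K W = finrank K D + (f (r + 1) - f r)} := by
      rintro D ⟨hD1, hD2, hD3⟩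
      have hDr : finrank K D = f r := by
        rw [← hD3 r le_rfl, inf_eq_left.2 hD2]
      ext W
      constructor
      · rintro ⟨⟨-, h2, h3⟩, h4⟩
        refine ⟨h2, h4, ?_⟩
        rw [← inf_eq_left.2 h2, h3 _ le_rfl, hDr]
        omega
      · rintro ⟨h2, h4, h5⟩
        refine ⟨⟨hD1.trans (h4 ▸ inf_le_left), h2, fun i hi => ?_⟩, h4⟩
        rcases Nat.lt_or_eq_of_le hi with hi | rfl
        · have hi' : i ≤ r := by omega
          rw [← hD3 i hi', ← h4, inf_assoc, inf_eq_right.2 (hA hi')]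
        · rw [inf_eq_left.2 h2, h5]
          omega
    have hcount : ∀ D ∈ S, ({W : Submodule K V | W ≤ A (r + 1) ∧ W ⊓ A r = D ∧
          finrank K W = finrank K D + (f (r + 1) - f r)}.ncard : ℝ) *
          q ^ ((f (r + 1) - f r) * c (r + 1)) =
        qBinom q (finrank K (A (r + 1)) - finrank K (A r)) (f (r + 1) - f r) := by
      rintro D ⟨hD1, hD2, hD3⟩
      have hDr : finrank K D = f r := by
        rw [← hD3 r le_rfl, inf_eq_left.2 hD2]
      -- `D` has codimension `c r` in `A r`, and adding the codimension `u - w` of the new step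
      -- gives `c (r + 1)`, the factor in the exponent.
      rw [← ncard_subspaces_inf_eq hq hD2 hArr
        (u := finrank K (A (r + 1)) - finrank K (A r)) (w := f (r + 1) - f r) (e := c r)
        (by omega) (by omega) (by omega)]
      congr 3
      omega
    have hmaps : ∀ W ∈ {W : Submodule K V | A 0 ≤ W ∧ W ≤ A (r + 1) ∧
        ∀ i ≤ r + 1, finrank K ((W ⊓ A i : Submodule K V)) = f i}, W ⊓ A r ∈ S := by
      rintro W ⟨h1, h2, h3⟩
      refine ⟨le_inf h1 (hA (Nat.zero_le r)), inf_le_right, fun i hi => ?_⟩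
      rw [inf_assoc, inf_eq_right.2 (hA hi), h3 i (by omega)]
    have hsum := Finset.sum_congr (rfl : (Set.toFinite S).toFinset = _) fun D hD =>
      (congrArg (fun X : Set (Submodule K V) =>
        (X.ncard : ℝ) * q ^ ((f (r + 1) - f r) * c (r + 1)))
        (hfib D ((Set.Finite.mem_toFinset _).1 hD))).trans
          (hcount D ((Set.Finite.mem_toFinset _).1 hD))
    rw [← Finset.sum_mul, ← Nat.cast_sum, ← ncard_eq_sum_fiber (Set.toFinite _) (Set.toFinite S)
      (fun W => W ⊓ A r) hmaps, Finset.sum_const, nsmul_eq_mul,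
      ← Set.ncard_eq_toFinset_card S (Set.toFinite S)] at hsum
    rw [mul_left_comm, hsum]
    ring

end Counting

/-! ### Row lengths of Young diagrams -/

theorem _root_.YoungDiagram.ext_rowLen {μ ν : YoungDiagram} (h : ∀ i, μ.rowLen i = ν.rowLen i) :
    μ = ν := by
  ext ⟨i, j⟩
  rw [YoungDiagram.mem_cells, YoungDiagram.mem_cells, YoungDiagram.mem_iff_lt_rowLen,
    YoungDiagram.mem_iff_lt_rowLen, h]

theorem rowLen_eq_zero_iff {μ : YoungDiagram} {r : ℕ} : μ.rowLen r = 0 ↔ μ.colLen 0 ≤ r := by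
  rw [← not_lt, ← YoungDiagram.mem_iff_lt_colLen, YoungDiagram.mem_iff_lt_rowLen, not_lt,
    Nat.le_zero]

theorem rowLen_eq_zero_of_le {μ : YoungDiagram} {r s : ℕ} (h : μ.rowLen r = 0) (hrs : r ≤ s) :
    μ.rowLen s = 0 :=
  Nat.le_zero.1 (h ▸ μ.rowLen_anti r s hrs)

theorem sum_rowLen {μ : YoungDiagram} {r : ℕ} (h : μ.rowLen r = 0) :
    ∑ i ∈ Finset.range r, μ.rowLen i = μ.card := by
  rw [YoungDiagram.card, Finset.card_eq_sum_card_fiberwise (f := Prod.fst) (t := Finset.range r)]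
  · refine Finset.sum_congr rfl fun i _ => ?_
    rw [YoungDiagram.rowLen_eq_card]
    rfl
  · rintro ⟨i, j⟩ hc
    have hc' : (i, j) ∈ μ := hc
    rw [YoungDiagram.mem_iff_lt_rowLen] at hc'
    simp only [Finset.coe_range, Set.mem_Iio]
    by_contra hi
    have := rowLen_eq_zero_of_le h (not_lt.1 hi)
    omega

theorem nPart_eq_sum {μ : YoungDiagram} {r : ℕ} (h : μ.rowLen r = 0) :
    nPart μ = ∑ i ∈ Finset.range r, (μ.rowLen i).choose 2 := by
  refine Finset.sum_subset (Finset.range_mono (rowLen_eq_zero_iff.1 h)) fun i _ hi => ?_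
  rw [rowLen_eq_zero_iff.2 (by simpa using hi)]
  rfl

theorem choose_two_add (a b : ℕ) :
    (a + b).choose 2 = a.choose 2 + b.choose 2 + a * b := by
  induction b with
  | zero => simp
  | succ b ih =>
    rw [← add_assoc, Nat.choose_succ_succ' (a + b) 1, Nat.choose_succ_succ' b 1, ih]
    simp only [Nat.choose_one_right]
    ring

/-- Identifies the exponent from the filtration count as a difference of the statistics `n(·)`. The
boundary term with `l r` makes the induction close, and vanishes once `r` exceeds the number of
rows. -/
theorem sum_choose_two_of_interlacing {l m : ℕ → ℕ} (h1 : ∀ i, m i ≤ l i)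
    (h2 : ∀ i, l (i + 1) ≤ m i) (r : ℕ) :
    ∑ i ∈ Finset.range r, (l i).choose 2 = ∑ i ∈ Finset.range r, (m i).choose 2 +
      (∑ i ∈ Finset.range r, (l i - m i)).choose 2 +
      ∑ i ∈ Finset.range r, (m i - l (i + 1)) * ∑ j ∈ Finset.range (i + 1), (l j - m j) +
      l r * ∑ i ∈ Finset.range r, (l i - m i) := by
  induction r with
  | zero => simp
  | succ r ih =>
    rw [Finset.sum_range_succ, ih, Finset.sum_range_succ (fun i => (m i).choose 2),
      Finset.sum_range_succ (fun i => (m i - l (i + 1)) * _),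
      Finset.sum_range_succ (fun i => l i - m i), choose_two_add]
    obtain ⟨c, hc⟩ := Nat.exists_eq_add_of_le (h1 r)
    obtain ⟨w, hw⟩ := Nat.exists_eq_add_of_le (h2 r)
    have e1 : l r - m r = c := by omega
    have e2 : m r - l (r + 1) = w := by omega
    rw [e1, e2, hc, choose_two_add, hw]
    ring

/-! ### Kernel dimensions of nilpotent endomorphisms -/

section KerDims

variable {K : Type*} [Field K] {V : Type*} [AddCommGroup V] [Module K V]

/-- The dimensions of the kernels of the powers of `N` on `W` are the partial sums of the row
lengths of `ν`. -/
def KerDims (N : Module.End K V) (W : Submodule K V) (ν : YoungDiagram) : Prop :=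
  ∀ i, finrank K (W ⊓ LinearMap.ker (N ^ i) : Submodule K V) = ∑ j ∈ Finset.range i, ν.rowLen j

theorem KerDims.unique {N : Module.End K V} {W : Submodule K V} {ν ν' : YoungDiagram}
    (h : KerDims N W ν) (h' : KerDims N W ν') : ν = ν' := by
  refine YoungDiagram.ext_rowLen fun i => ?_
  have h1 := (h i).symm.trans (h' i)
  have h2 := (h (i + 1)).symm.trans (h' (i + 1))
  rw [Finset.sum_range_succ, Finset.sum_range_succ] at h2
  omega

theorem KerDims.finrank_eq {N : Module.End K V} (hN : IsNilpotent N) {W : Submodule K V}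
    {ν : YoungDiagram} (h : KerDims N W ν) : finrank K W = ν.card := by
  obtain ⟨m, hm⟩ := hN
  -- This exponent both annihilates `N` and reaches past the last row of `ν`.
  have h1 : N ^ (m + ν.colLen 0) = 0 := by rw [pow_add, hm, zero_mul]
  have h2 := h (m + ν.colLen 0)
  rwa [h1, LinearMap.ker_zero, inf_top_eq, sum_rowLen (rowLen_eq_zero_iff.2 (by omega))] at h2

theorem map_inf_ker_pow (N : Module.End K V) (W : Submodule K V) (i : ℕ) :
    (W ⊓ LinearMap.ker (N ^ (i + 1))).map N = W.map N ⊓ LinearMap.ker (N ^ i) := by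
  ext x
  simp only [mem_map, mem_inf, LinearMap.mem_ker]
  constructor
  · rintro ⟨y, ⟨hy, hy'⟩, rfl⟩
    exact ⟨⟨y, hy, rfl⟩, by rw [← hy', pow_succ]; rfl⟩
  · rintro ⟨⟨y, hy, rfl⟩, hy'⟩
    exact ⟨y, ⟨hy, by rw [← hy', pow_succ]; rfl⟩, rfl⟩

variable [Module.Finite K V]

theorem KerDims.le_ker {N : Module.End K V} (hN : IsNilpotent N) {W : Submodule K V}
    {ν : YoungDiagram} (h : KerDims N W ν) {r : ℕ} (hr : ν.rowLen r = 0) :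
    W ≤ LinearMap.ker (N ^ r) := by
  rw [← inf_eq_left]
  exact Submodule.eq_of_le_of_finrank_eq inf_le_left
    (by rw [h r, sum_rowLen hr, h.finrank_eq hN])

theorem finrank_map_add_finrank_inf_ker (N : Module.End K V) (X : Submodule K V) :
    finrank K (X.map N) + finrank K (X ⊓ LinearMap.ker N : Submodule K V) = finrank K X := by
  rw [← (N.domRestrict X).finrank_range_add_finrank_ker, LinearMap.range_domRestrict,
    LinearMap.ker_domRestrict, ← finrank_map_subtype_eq X, Submodule.map_comap_subtype]

/-- Applying `N` shortens every Jordan block by one, which deletes the first row of `ν`. The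
dimensions follow from rank-nullity for `N` on `W ⊓ ker (N ^ (i + 1))`. -/
theorem KerDims.finrank_map_inf_ker {N : Module.End K V} {W : Submodule K V}
    {ν : YoungDiagram} (h : KerDims N W ν) (i : ℕ) :
    finrank K (W.map N ⊓ LinearMap.ker (N ^ i) : Submodule K V) =
      ∑ j ∈ Finset.range i, ν.rowLen (j + 1) := by
  have h1 := finrank_map_add_finrank_inf_ker N (W ⊓ LinearMap.ker (N ^ (i + 1)))
  have h2 : W ⊓ LinearMap.ker (N ^ (i + 1)) ⊓ LinearMap.ker N = W ⊓ LinearMap.ker (N ^ 1) := by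
    have h3 : LinearMap.ker N ≤ LinearMap.ker (N ^ (i + 1)) := by
      rw [pow_succ]
      exact LinearMap.ker_le_ker_comp _ _
    rw [inf_assoc, pow_one, inf_eq_right.2 h3]
  rw [map_inf_ker_pow, h2, h, h, Finset.sum_range_one, Finset.sum_range_succ'] at h1
  omega

/-- By the modular law the intersection is `N W + (W' ⊓ ker (N ^ i))`. This translates kernel
dimensions of `W'` into its position relative to the filtration between `N W` and `W`. -/
theorem KerDims.finrank_inf_filtration {N : Module.End K V} {W W' : Submodule K V}
    {ν : YoungDiagram} (h : KerDims N W ν) (h1 : W.map N ≤ W') (h2 : W' ≤ W) (i : ℕ) :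
    finrank K (W' ⊓ (W.map N ⊔ W ⊓ LinearMap.ker (N ^ i)) : Submodule K V) +
      ∑ j ∈ Finset.range i, ν.rowLen (j + 1) =
    finrank K (W.map N) + finrank K (W' ⊓ LinearMap.ker (N ^ i) : Submodule K V) := by
  rw [inf_comm W', sup_inf_assoc_of_le _ h1, inf_assoc, inf_comm (LinearMap.ker _), ← inf_assoc,
    inf_eq_right.2 h2, ← finrank_sup_add_finrank_inf_eq, ← inf_assoc, inf_eq_left.2 h1,
    h.finrank_map_inf_ker]

/-- The subspaces `W'` with `N W ≤ W' ≤ W` on which `N` has a prescribed type. -/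
theorem KerDims.ncard_mul_pow [Finite K] {q : ℝ} (hq : q⁻¹ = (Nat.card K : ℝ))
    {N : Module.End K V} (hN : IsNilpotent N) {W : Submodule K V} {l m : YoungDiagram}
    (h : KerDims N W l) (hW : W.map N ≤ W) (h1 : ∀ i, m.rowLen i ≤ l.rowLen i)
    (h2 : ∀ i, l.rowLen (i + 1) ≤ m.rowLen i) {r : ℕ} (hr : l.rowLen r = 0) :
    ({W' : Submodule K V | W.map N ≤ W' ∧ W' ≤ W ∧ KerDims N W' m}.ncard : ℝ) * q ^ nPart l =
      q ^ (nPart m + (l.card - m.card).choose 2) *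
        ∏ i ∈ Finset.range r,
          qBinom q (l.rowLen i - l.rowLen (i + 1)) (l.rowLen i - m.rowLen i) := by
  have hmr : m.rowLen r = 0 := Nat.le_zero.1 (hr ▸ h1 r)
  -- `f i` is the dimension which `W' ⊓ A i` must have for `W'` of type `m`, and `c i` is the
  -- resulting codimension in `A i`.
  set A : ℕ → Submodule K V := fun i => W.map N ⊔ W ⊓ LinearMap.ker (N ^ i) with hA
  set f : ℕ → ℕ := fun i =>
    finrank K (W.map N) + ∑ j ∈ Finset.range i, (m.rowLen j - l.rowLen (j + 1)) with hf
  set c : ℕ → ℕ := fun i => ∑ j ∈ Finset.range i, (l.rowLen j - m.rowLen j) with hc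
  have hAle : ∀ i, A i ≤ W := fun i => sup_le hW inf_le_left
  have hfs : ∀ i, f (i + 1) = f i + (m.rowLen i - l.rowLen (i + 1)) := fun i => by
    simp only [hf, Finset.sum_range_succ, add_assoc]
  have hcs : ∀ i, c (i + 1) = c i + (l.rowLen i - m.rowLen i) := fun i => by
    simp only [hc, Finset.sum_range_succ]
  have hker : Monotone fun i => LinearMap.ker (N ^ i) := monotone_nat_of_le_succ fun i => by
    rw [pow_succ']
    exact LinearMap.ker_le_ker_comp _ _
  have hAm : Monotone A := fun i j hij => sup_le_sup_left (inf_le_inf_left _ (hker hij)) _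
  have hA0 : A 0 = W.map N := by
    simp [hA, Module.End.one_eq_id]
  have hAr : A r = W := by
    simp only [hA]
    rw [inf_eq_left.2 (h.le_ker hN hr), sup_eq_right.2 hW]
  have hml : ∀ i, f i + ∑ j ∈ Finset.range i, l.rowLen (j + 1) =
      finrank K (W.map N) + ∑ j ∈ Finset.range i, m.rowLen j := fun i => by
    simp only [hf]
    rw [add_assoc, ← Finset.sum_add_distrib]
    congr 1
    exact Finset.sum_congr rfl fun j _ => Nat.sub_add_cancel (h2 j)
  have hlc : ∀ i, ∑ j ∈ Finset.range i, l.rowLen j = ∑ j ∈ Finset.range i, m.rowLen j + c i :=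
    fun i => by
      simp only [hc]
      rw [← Finset.sum_add_distrib]
      exact Finset.sum_congr rfl fun j _ => (Nat.add_sub_cancel' (h1 j)).symm
  have hcA : ∀ i, finrank K (A i) = f i + c i := fun i => by
    have e := h.finrank_inf_filtration hW le_rfl i
    change finrank K (W ⊓ A i : Submodule K V) + _ = _ at e
    rw [inf_eq_right.2 (hAle i), h i] at e
    have e2 := hml i
    have e3 := hlc i
    omega
  have hset : {W' : Submodule K V | W.map N ≤ W' ∧ W' ≤ W ∧ KerDims N W' m} =
      {W' : Submodule K V | A 0 ≤ W' ∧ W' ≤ A r ∧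
        ∀ i ≤ r, finrank K (W' ⊓ A i : Submodule K V) = f i} := by
    ext W'
    rw [hA0, hAr]
    refine and_congr_right fun hW1 => and_congr_right fun hW2 => ?_
    have e : ∀ i, finrank K (W' ⊓ A i : Submodule K V) = f i ↔
        finrank K (W' ⊓ LinearMap.ker (N ^ i) : Submodule K V) =
          ∑ j ∈ Finset.range i, m.rowLen j := fun i => by
      have e1 := h.finrank_inf_filtration hW1 hW2 i
      change finrank K (W' ⊓ A i : Submodule K V) + _ = _ at e1
      have e2 := hml i
      omega
    simp only [e]
    refine ⟨fun H i _ => H i, fun H i => ?_⟩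
    -- Beyond `r` nothing new is required: `W'` lies in `ker (N ^ r)` and `m` has no further rows.
    rcases le_total i r with hi | hi
    · exact H i hi
    · have k1 : W' ≤ LinearMap.ker (N ^ r) := hW2.trans (h.le_ker hN hr)
      have k2 := H r le_rfl
      rw [inf_eq_left.2 k1, sum_rowLen hmr] at k2
      rw [inf_eq_left.2 (k1.trans (hker hi)), sum_rowLen (rowLen_eq_zero_of_le hmr hi), k2]
  have key := ncard_subspaces_filtration hq hAm (f := f) (c := c) (by rw [hA0]; simp [hf])
    (monotone_nat_of_le_succ fun i => by rw [hfs]; omega) hcA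
    (monotone_nat_of_le_succ fun i => by rw [hcs]; omega) r
  rw [← hset] at key
  have hprod : ∏ i ∈ Finset.range r,
        qBinom q (finrank K (A (i + 1)) - finrank K (A i)) (f (i + 1) - f i) =
      ∏ i ∈ Finset.range r,
        qBinom q (l.rowLen i - l.rowLen (i + 1)) (l.rowLen i - m.rowLen i) := by
    refine Finset.prod_congr rfl fun i _ => ?_
    have k1 := h1 i
    have k2 := h2 i
    -- The filtration yields the lower index `m_i - l_{i+1}`, complementary to the one in the
    -- weight.
    rw [← qBinom_symm q (by omega : l.rowLen i - m.rowLen i ≤ l.rowLen i - l.rowLen (i + 1)),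
      hcA, hcA, hfs, hcs]
    congr 1 <;> omega
  rw [hprod] at key
  rw [← key, nPart_eq_sum hr, nPart_eq_sum hmr, sum_choose_two_of_interlacing h1 h2, hr, zero_mul,
    add_zero, pow_add]
  have hd : l.card - m.card = ∑ j ∈ Finset.range r, (l.rowLen j - m.rowLen j) := by
    have := hlc r
    rw [sum_rowLen hr, sum_rowLen hmr] at this
    exact (Nat.sub_eq_of_eq_add' this)
  rw [hd]
  simp only [hfs, Nat.add_sub_cancel_left, hc]
  ring

/-- The types of `N` on subspaces `N W ≤ W' ≤ W` interlace. -/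
theorem KerDims.interlacing {N : Module.End K V} {W W' : Submodule K V} {l m : YoungDiagram}
    (h : KerDims N W l) (h' : KerDims N W' m) (h1 : W.map N ≤ W') (h2 : W' ≤ W) (i : ℕ) :
    m.rowLen i ≤ l.rowLen i ∧ l.rowLen (i + 1) ≤ m.rowLen i := by
  have hker : LinearMap.ker (N ^ i) ≤ LinearMap.ker (N ^ (i + 1)) := by
    rw [pow_succ']
    exact LinearMap.ker_le_ker_comp _ _
  constructor
  · have e := finrank_sup_add_finrank_inf_eq (W' ⊓ LinearMap.ker (N ^ (i + 1)))
      (W ⊓ LinearMap.ker (N ^ i))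
    have e1 : W' ⊓ LinearMap.ker (N ^ (i + 1)) ⊓ (W ⊓ LinearMap.ker (N ^ i)) =
        W' ⊓ LinearMap.ker (N ^ i) := by
      rw [inf_inf_inf_comm, inf_eq_left.2 h2, inf_eq_right.2 hker]
    have e2 := finrank_mono (sup_le (inf_le_inf_right (LinearMap.ker (N ^ (i + 1))) h2)
      (inf_le_inf_left W hker))
    rw [e1] at e
    rw [h, Finset.sum_range_succ] at e2
    rw [h', h, h', Finset.sum_range_succ] at e
    omega
  · have e := finrank_sup_add_finrank_inf_eq (W.map N ⊓ LinearMap.ker (N ^ (i + 1)))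
      (W' ⊓ LinearMap.ker (N ^ i))
    have e1 : W.map N ⊓ LinearMap.ker (N ^ (i + 1)) ⊓ (W' ⊓ LinearMap.ker (N ^ i)) =
        W.map N ⊓ LinearMap.ker (N ^ i) := by
      rw [inf_inf_inf_comm, inf_eq_left.2 h1, inf_eq_right.2 hker]
    have e2 := finrank_mono (sup_le (inf_le_inf_right (LinearMap.ker (N ^ (i + 1))) h1)
      (inf_le_inf_left W' hker))
    rw [e1] at e
    rw [h', Finset.sum_range_succ] at e2
    rw [h.finrank_map_inf_ker, h.finrank_map_inf_ker, h', Finset.sum_range_succ] at e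
    omega

end KerDims

/-! ### Jordan forms and kernel dimensions -/

section JordanForm

variable {K : Type*} [Field K] {V : Type*} [AddCommGroup V] [Module K V]

theorem toMatrix_eq_jordanMatrix_iff {ρ : YoungDiagram} (b : Basis ρ.cells K V)
    (M : Module.End K V) :
    LinearMap.toMatrix b b M = jordanMatrix K ρ ↔
      (∀ i j (h : (i, j + 1) ∈ ρ.cells), M (b ⟨(i, j + 1), h⟩) =
        b ⟨(i, j), ρ.isLowerSet (Prod.mk_le_mk.2 ⟨le_rfl, j.le_succ⟩) h⟩) ∧
      ∀ i (h : (i, 0) ∈ ρ.cells), M (b ⟨(i, 0), h⟩) = 0 := by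
  constructor
  · intro H
    have H' : ∀ y x, b.repr (M (b y)) x = jordanMatrix K ρ x y := fun y x => by
      rw [← H, LinearMap.toMatrix_apply]
    constructor
    · intro i j h
      apply b.repr.injective
      ext ⟨⟨i', j'⟩, hx⟩
      rw [H', b.repr_self, Finsupp.single_apply]
      simp [jordanMatrix, eq_comm]
    · intro i h
      apply b.repr.injective
      ext ⟨⟨i', j'⟩, hx⟩
      rw [H']
      simp [jordanMatrix]
  · rintro ⟨h1, h2⟩
    ext ⟨⟨i', j'⟩, hx⟩ ⟨⟨i, j⟩, hy⟩
    rw [LinearMap.toMatrix_apply]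
    rcases j with _ | j
    · rw [h2]
      simp [jordanMatrix]
    · rw [h1, b.repr_self, Finsupp.single_apply]
      simp [jordanMatrix, eq_comm]

theorem card_filter_snd_lt (ρ : YoungDiagram) (i : ℕ) :
    (ρ.cells.filter fun c => c.2 < i).card = ∑ j ∈ Finset.range i, ρ.colLen j := by
  rw [Finset.card_eq_sum_card_fiberwise (f := Prod.snd) (t := Finset.range i)]
  · refine Finset.sum_congr rfl fun j hj => ?_
    rw [YoungDiagram.colLen_eq_card]
    congr 1
    ext c
    simp only [Finset.mem_filter, YoungDiagram.col]
    have := Finset.mem_range.1 hj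
    constructor
    · rintro ⟨⟨h1, h2⟩, h3⟩
      exact ⟨h1, h3⟩
    · rintro ⟨h1, rfl⟩
      exact ⟨⟨h1, this⟩, rfl⟩
  · intro c hc
    simpa using (Finset.mem_filter.1 hc).2

/-- `M ^ i` moves every string `i` places to the left, so its rank is the number of boxes of
`ν.transpose` in columns `≥ i`. The nullity counts the other columns, whose lengths are the first
`i` rows of `ν`. -/
theorem IsJF.finrank_ker_pow {M : Module.End K V} {ν : YoungDiagram} (h : IsJF M ν) (i : ℕ) :
    finrank K (LinearMap.ker (M ^ i)) = ∑ j ∈ Finset.range i, ν.rowLen j := by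
  obtain ⟨b, hb⟩ := h
  obtain ⟨h1, h2⟩ := (toMatrix_eq_jordanMatrix_iff b M).1 hb
  have := Module.Finite.of_basis b
  have hsucc : ∀ i r c (h : (r, c + i) ∈ ν.transpose.cells), (M ^ i) (b ⟨(r, c + i), h⟩) =
      b ⟨(r, c), ν.transpose.isLowerSet (Prod.mk_le_mk.2 ⟨le_rfl, Nat.le_add_right c i⟩) h⟩ := by
    intro i
    induction i with
    | zero => intro r c h; rfl
    | succ i ih =>
      intro r c h
      rw [pow_succ, Module.End.mul_apply]
      exact (congrArg (M ^ i) (h1 r (c + i) h)).trans (ih r c _)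
  have hzero : ∀ i r c (h : (r, c) ∈ ν.transpose.cells), c < i →
      (M ^ i) (b ⟨(r, c), h⟩) = 0 := by
    intro i
    induction i with
    | zero => intro r c h hc; omega
    | succ i ih =>
      intro r c h hc
      rw [pow_succ, Module.End.mul_apply]
      rcases c with _ | c
      · rw [h2, map_zero]
      · rw [h1]
        exact ih r c _ (by omega)
  let S := {x : ν.transpose.cells // i ≤ x.1.2}
  let g : S → ν.transpose.cells := fun x =>
    ⟨(x.1.1.1, x.1.1.2 - i), ν.transpose.isLowerSet
      (Prod.mk_le_mk.2 ⟨le_rfl, Nat.sub_le _ _⟩) x.1.2⟩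
  have hg : ∀ x : S, (M ^ i) (b x.1) = b (g x) := by
    rintro ⟨⟨⟨r, c⟩, h⟩, hc⟩
    obtain ⟨c, rfl⟩ := Nat.exists_eq_add_of_le' hc
    rw [hsucc]
    congr 2
    simp
  have hginj : Function.Injective g := by
    rintro ⟨⟨⟨r, c⟩, h⟩, hc⟩ ⟨⟨⟨r', c'⟩, h'⟩, hc'⟩ e
    simp only [g, Subtype.mk.injEq, Prod.mk.injEq] at e hc hc'
    exact Subtype.ext (Subtype.ext (Prod.ext e.1 (by simp only; omega)))
  have hrange : LinearMap.range (M ^ i) = span K (Set.range (b ∘ g)) := by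
    rw [LinearMap.range_eq_map, ← b.span_eq, Submodule.map_span]
    apply le_antisymm
    · rw [span_le]
      rintro _ ⟨_, ⟨⟨⟨r, c⟩, h⟩, rfl⟩, rfl⟩
      rcases lt_or_ge c i with hc | hc
      · rw [hzero i r c h hc]
        exact zero_mem _
      · exact subset_span ⟨⟨⟨(r, c), h⟩, hc⟩, (hg _).symm⟩
    · rw [span_le]
      rintro _ ⟨x, rfl⟩
      exact subset_span ⟨b x.1, ⟨x.1, rfl⟩, hg x⟩
  have hcard := (M ^ i).finrank_range_add_finrank_ker
  rw [hrange, finrank_span_eq_card (b.linearIndependent.comp g hginj),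
    finrank_eq_card_basis b, Fintype.card_coe] at hcard
  have hS : Fintype.card S = (ν.transpose.cells.filter fun c => ¬ c.2 < i).card := by
    rw [← Fintype.card_coe]
    refine Fintype.card_congr
      { toFun := fun x => ⟨x.1.1, Finset.mem_filter.2 ⟨x.1.2, not_lt.2 x.2⟩⟩
        invFun := fun x => ⟨⟨x.1, (Finset.mem_filter.1 x.2).1⟩,
          not_lt.1 (Finset.mem_filter.1 x.2).2⟩
        left_inv := fun x => rfl
        right_inv := fun x => rfl }
  have hsplit := Finset.card_filter_add_card_filter_not (s := ν.transpose.cells)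
    (fun c => c.2 < i)
  rw [card_filter_snd_lt] at hsplit
  simp only [YoungDiagram.colLen_transpose] at hsplit
  omega

/-- The power basis is reversed so that multiplication by `X` lowers the index, as required for ones
on the superdiagonal. -/
theorem exists_basis_quotient_X_pow (K : Type*) [Field K] (k : ℕ) :
    ∃ B : Basis (Fin k) K
        (Polynomial K ⧸ (span (Polynomial K) {(Polynomial.X : Polynomial K) ^ k})),
      ∀ j, B j = Submodule.Quotient.mk (Polynomial.X ^ (k - 1 - (j : ℕ))) := by
  let pb := AdjoinRoot.powerBasis' (Polynomial.monic_X_pow (R := K) k)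
  have hdim : pb.dim = k := by simp [pb]
  let B := (pb.basis.reindex (finCongr hdim)).reindex Fin.revPerm
  refine ⟨B, fun j => ?_⟩
  have : B j = pb.gen ^ (k - 1 - (j : ℕ)) := by
    simp only [B, Basis.reindex_apply, PowerBasis.coe_basis]
    congr 1
    simp
    omega
  exact this.trans rfl

/-- A nilpotent endomorphism has a basis consisting of strings. -/
theorem exists_basis_strings [Module.Finite K V] {M : Module.End K V} (hM : IsNilpotent M) :
    ∃ (d : ℕ) (k : Fin d → ℕ) (b : Basis (Σ i, Fin (k i)) K V),
      (∀ i j (h : j + 1 < k i), M (b ⟨i, j + 1, h⟩) = b ⟨i, j, (Nat.lt_succ_self j).trans h⟩) ∧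
      ∀ i (h : 0 < k i), M (b ⟨i, 0, h⟩) = 0 := by
  classical
  obtain ⟨m, hm⟩ := hM
  -- Nilpotency makes `V`, with `X` acting as `M`, an `X`-power torsion module over `K[X]`; the
  -- structure theorem splits it into summands `K[X] / (X ^ k i)`, one for each string.
  have htors : Module.IsTorsion' (AEval' M) (Submonoid.powers (Polynomial.X : Polynomial K)) := by
    intro x
    refine ⟨⟨Polynomial.X ^ m, m, rfl⟩, ?_⟩
    change (Polynomial.X ^ m : Polynomial K) • x = 0
    have := AEval'.X_pow_smul_of M ((AEval'.of M).symm x) m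
    rw [LinearEquiv.apply_symm_apply] at this
    rw [this, hm]
    simp
  obtain ⟨d, k, ⟨e⟩⟩ := Module.torsion_by_prime_power_decomposition
    (Polynomial.prime_X.irreducible) htors
  choose B hB using fun i => exists_basis_quotient_X_pow K (k i)
  let e' := (e.trans (DirectSum.linearEquivFunOnFintype _ _ _)).restrictScalars K
  let b : Basis (Σ i, Fin (k i)) K V := (Pi.basis B).map (e'.symm.trans (AEval'.of M).symm)
  have hb : ∀ i j, e' (AEval'.of M (b ⟨i, j⟩)) = Pi.single i (B i j) := fun i j => by
    simp [b]
  have hbX : ∀ x, e' (AEval'.of M (M x)) = (Polynomial.X : Polynomial K) • e' (AEval'.of M x) :=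
    fun x => by
      rw [← AEval'.X_smul_of]
      exact map_smul (e.trans (DirectSum.linearEquivFunOnFintype _ _ _)) _ _
  have hinj : Function.Injective fun x => e' (AEval'.of M x) :=
    e'.injective.comp (AEval'.of M).injective
  refine ⟨d, k, b, fun i j h => hinj ?_, fun i h => hinj ?_⟩
  · simp only
    rw [hbX, hb, hb, ← Pi.single_smul, hB, hB, ← Submodule.Quotient.mk_smul, smul_eq_mul,
      ← pow_succ']
    congr 3
    simp only
    omega
  · simp only
    rw [hbX, hb, ← Pi.single_smul, hB, ← Submodule.Quotient.mk_smul, smul_eq_mul, ← pow_succ',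
      (Submodule.Quotient.mk_eq_zero _).2, Pi.single_zero, map_zero, map_zero]
    rw [Nat.sub_zero, Nat.sub_add_cancel h]
    exact mem_span_singleton_self _

theorem exists_isJF [Module.Finite K V] {M : Module.End K V} (hM : IsNilpotent M) :
    ∃ ν, IsJF M ν := by
  obtain ⟨d, k, b, h1, h2⟩ := exists_basis_strings hM
  -- Sorting the strings by decreasing length makes them the rows of a Young diagram.
  let σ : Equiv.Perm (Fin d) := Tuple.sort (OrderDual.toDual ∘ k)
  have hσ : Antitone (k ∘ σ) := Tuple.monotone_sort (OrderDual.toDual ∘ k)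
  let ρ : YoungDiagram :=
    { cells := Finset.univ.image fun x : Σ i, Fin (k (σ i)) => ((x.1 : ℕ), (x.2 : ℕ))
      isLowerSet := by
        rintro ⟨a, b⟩ ⟨c, e⟩ h hab
        obtain ⟨hca, heb⟩ := Prod.mk_le_mk.1 h
        simp only [Finset.coe_image, Finset.coe_univ, Set.image_univ, Set.mem_range,
          Prod.mk.injEq] at hab ⊢
        obtain ⟨⟨i, j⟩, rfl, rfl⟩ := hab
        have hc : c < d := hca.trans_lt i.2
        exact ⟨⟨⟨c, hc⟩, ⟨e, (heb.trans_lt j.2).trans_le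
          (hσ (show (⟨c, hc⟩ : Fin d) ≤ i from hca))⟩⟩, rfl, rfl⟩ }
  have hmem : ∀ c : ℕ × ℕ, c ∈ ρ.cells ↔ ∃ h : c.1 < d, c.2 < k (σ ⟨c.1, h⟩) := by
    rintro ⟨i, j⟩
    simp only [ρ, Finset.mem_image, Finset.mem_univ, true_and]
    constructor
    · rintro ⟨x, hx⟩
      obtain ⟨rfl, rfl⟩ := Prod.mk.injEq _ _ _ _ ▸ hx
      exact ⟨x.1.2, x.2.2⟩
    · rintro ⟨h, h'⟩
      exact ⟨⟨⟨i, h⟩, ⟨j, h'⟩⟩, rfl⟩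
  let E : (Σ i, Fin (k i)) ≃ ρ.cells :=
    { toFun := fun x => ⟨((σ.symm x.1 : ℕ), (x.2 : ℕ)), (hmem _).2 ⟨(σ.symm x.1).2, by simp⟩⟩
      invFun := fun c => ⟨σ ⟨c.1.1, ((hmem _).1 c.2).1⟩, ⟨c.1.2, ((hmem _).1 c.2).2⟩⟩
      left_inv := by
        rintro ⟨i, j⟩
        refine Sigma.ext (by simp) ((Fin.heq_ext_iff (by simp)).2 rfl)
      right_inv := by
        rintro ⟨⟨i, j⟩, h⟩
        simp }
  refine ⟨ρ.transpose, ?_⟩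
  -- The goal is indexed by the boxes of `ρ.transpose.transpose`; generalizing this diagram allows
  -- it to be replaced by `ρ`.
  suffices H : ∀ ρ', ρ' = ρ → ∃ b : Basis ρ'.cells K V,
      LinearMap.toMatrix b b M = jordanMatrix K ρ' from H _ ρ.transpose_transpose
  rintro _ rfl
  refine ⟨b.reindex E, (toMatrix_eq_jordanMatrix_iff _ _).2 ⟨fun i j h => ?_, fun i h => ?_⟩⟩
  · rw [Basis.reindex_apply, Basis.reindex_apply]
    exact h1 _ _ _
  · rw [Basis.reindex_apply]
    exact h2 _ _

theorem exists_isJF_restrict [Module.Finite K V] {N : Module.End K V} (hN : IsNilpotent N)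
    {W : Submodule K V} (hW : ∀ x ∈ W, N x ∈ W) : ∃ ν, IsJF (N.restrict hW) ν := by
  obtain ⟨m, hm⟩ := hN
  refine exists_isJF ⟨m, ?_⟩
  rw [Module.End.pow_restrict]
  ext x
  simp [hm]

/-- For the converse, some Jordan form exists, and its partition is determined by the kernel
dimensions. -/
theorem isJF_restrict_iff [Module.Finite K V] {N : Module.End K V} (hN : IsNilpotent N)
    {W : Submodule K V} (hW : ∀ x ∈ W, N x ∈ W) {ν : YoungDiagram} :
    IsJF (N.restrict hW) ν ↔ KerDims N W ν := by
  have key : ∀ ν, IsJF (N.restrict hW) ν → KerDims N W ν := fun ν h i => by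
    rw [← h.finrank_ker_pow i, Module.End.pow_restrict, LinearMap.ker_restrict,
      ← finrank_map_subtype_eq W, Submodule.map_comap_subtype]
  refine ⟨key ν, fun h => ?_⟩
  obtain ⟨ν', h'⟩ := exists_isJF_restrict hN hW
  rwa [h.unique (key ν' h')]

theorem IsJF.kerDims_top {N : Module.End K V} {ν : YoungDiagram} (h : IsJF N ν) :
    KerDims N ⊤ ν := fun i => by
  rw [top_inf_eq, h.finrank_ker_pow]

end JordanForm

/-! ### Semistandard tableaux as chains of partitions -/

section Tableau

variable {μ : YoungDiagram}

theorem mem_upTo {T : SemistandardYoungTableau μ} {k i j : ℕ} :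
    (i, j) ∈ upTo T k ↔ (i, j) ∈ μ ∧ T i j < k := by
  rw [← YoungDiagram.mem_cells, upTo, Finset.mem_filter, YoungDiagram.mem_cells]

theorem rowLen_le_iff {μ ν : YoungDiagram} {i i' : ℕ} :
    μ.rowLen i ≤ ν.rowLen i' ↔ ∀ j, (i, j) ∈ μ → (i', j) ∈ ν := by
  simp only [YoungDiagram.mem_iff_lt_rowLen]
  exact ⟨fun h j hj => hj.trans_le h, fun h => le_of_forall_lt h⟩

theorem upTo_zero (T : SemistandardYoungTableau μ) : upTo T 0 = ⊥ := by
  ext ⟨i, j⟩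
  simp [upTo]

theorem rowLen_upTo_mono (T : SemistandardYoungTableau μ) {k l : ℕ} (h : k ≤ l) (i : ℕ) :
    (upTo T k).rowLen i ≤ (upTo T l).rowLen i :=
  rowLen_le_iff.2 fun _ hj => mem_upTo.2 ⟨(mem_upTo.1 hj).1, (mem_upTo.1 hj).2.trans_le h⟩

theorem rowLen_upTo_le (T : SemistandardYoungTableau μ) (k i : ℕ) :
    (upTo T k).rowLen i ≤ μ.rowLen i :=
  rowLen_le_iff.2 fun _ hj => (mem_upTo.1 hj).1

theorem rowLen_succ_upTo_succ_le (T : SemistandardYoungTableau μ) (k i : ℕ) :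
    (upTo T (k + 1)).rowLen (i + 1) ≤ (upTo T k).rowLen i :=
  rowLen_le_iff.2 fun _ hj => by
    obtain ⟨h1, h2⟩ := mem_upTo.1 hj
    have := T.col_strict (Nat.lt_add_one i) h1
    exact mem_upTo.2 ⟨μ.up_left_mem i.le_succ le_rfl h1, by omega⟩

theorem upTo_injective {T T' : SemistandardYoungTableau μ} (h : ∀ k, upTo T k = upTo T' k) :
    T = T' := by
  ext i j
  by_cases hc : (i, j) ∈ μ
  · have key : ∀ k, T i j < k ↔ T' i j < k := fun k => by
      have h1 := mem_upTo (T := T) (k := k) (i := i) (j := j)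
      have h2 := mem_upTo (T := T') (k := k) (i := i) (j := j)
      rw [h k, h2] at h1
      simpa [hc] using h1.symm
    have h1 := (key (T i j + 1)).1 (Nat.lt_succ_self _)
    have h2 := (key (T' i j + 1)).2 (Nat.lt_succ_self _)
    omega
  · rw [T.zeros hc, T'.zeros hc]

theorem content_apply (T : SemistandardYoungTableau μ) (j : ℕ) :
    content T j = (μ.cells.filter fun c => T c.1 c.2 = j).card := by
  rw [content, Finsupp.finsetSum_apply, Finset.card_filter]
  exact Finset.sum_congr rfl fun c _ => Finsupp.single_apply

theorem card_upTo (T : SemistandardYoungTableau μ) (k : ℕ) :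
    (upTo T k).card = ∑ j ∈ Finset.range k, content T j := by
  rw [YoungDiagram.card, Finset.card_eq_sum_card_fiberwise (f := fun c => T c.1 c.2)
    (t := Finset.range k)]
  · refine Finset.sum_congr rfl fun j hj => ?_
    rw [content_apply]
    congr 1
    ext c
    have := Finset.mem_range.1 hj
    simp only [upTo, Finset.mem_filter]
    constructor
    · rintro ⟨⟨h1, -⟩, h3⟩
      exact ⟨h1, h3⟩
    · rintro ⟨h1, rfl⟩
      exact ⟨⟨h1, this⟩, rfl⟩
  · rintro c hc
    simpa using (Finset.mem_filter.1 hc).2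

theorem upTo_eq_of_content {T : SemistandardYoungTableau μ} {k : ℕ}
    (h : ∀ j, k ≤ j → content T j = 0) {l : ℕ} (hl : k ≤ l) : upTo T l = μ := by
  ext ⟨i, j⟩
  rw [YoungDiagram.mem_cells, YoungDiagram.mem_cells, mem_upTo]
  refine ⟨fun H => H.1, fun H => ⟨H, ?_⟩⟩
  by_contra hlt
  have h1 := h (T i j) (by omega)
  rw [content_apply, Finset.card_eq_zero] at h1
  exact Finset.notMem_empty (i, j) (h1 ▸ Finset.mem_filter.2 ⟨(YoungDiagram.mem_cells _).2 H, rfl⟩)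

/-- An interlacing chain of partitions from `⊥` to `μ` comes from a semistandard tableau. -/
theorem exists_tableau {Y : ℕ → YoungDiagram} (h0 : Y 0 = ⊥)
    (h1 : ∀ k i, (Y k).rowLen i ≤ (Y (k + 1)).rowLen i)
    (h2 : ∀ k i, (Y (k + 1)).rowLen (i + 1) ≤ (Y k).rowLen i) {m : ℕ}
    (hm : ∀ k, m ≤ k → Y k = μ) : ∃ T : SemistandardYoungTableau μ, ∀ k, upTo T k = Y k := by
  have hmono : ∀ k l, k ≤ l → ∀ i, (Y k).rowLen i ≤ (Y l).rowLen i := fun k l hkl i =>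
    monotone_nat_of_le_succ (f := fun k => (Y k).rowLen i) (fun k => h1 k i) hkl
  have hmem : ∀ k l, k ≤ l → ∀ i j, (i, j) ∈ Y k → (i, j) ∈ Y l := fun k l hkl i =>
    rowLen_le_iff.1 (hmono k l hkl i)
  have hμ : ∀ k i j, (i, j) ∈ Y k → (i, j) ∈ μ := fun k i j h => by
    rw [← hm (max k m) (le_max_right _ _)]
    exact hmem _ _ (le_max_left _ _) _ _ h
  -- The entry `t` is least with `(i, j) ∈ Y (t + 1)`: letters start at `0`, so letter `t` enters
  -- between `Y t` and `Y (t + 1)`.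
  have hex : ∀ i j, ∃ t, ((i, j) ∈ μ → ∀ l, t < l ↔ (i, j) ∈ Y l) ∧ ((i, j) ∉ μ → t = 0) := by
    classical
    intro i j
    by_cases hc : (i, j) ∈ μ
    · have hex : ∃ k, (i, j) ∈ Y (k + 1) := ⟨m, by rwa [hm _ m.le_succ]⟩
      refine ⟨Nat.find hex, fun _ l => ⟨fun hl => ?_, fun hl => ?_⟩, fun h => absurd hc h⟩
      · exact hmem _ _ hl _ _ (Nat.find_spec hex)
      · rcases l with _ | l
        · rw [h0] at hl
          exact absurd hl (YoungDiagram.notMem_bot _)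
        · exact Nat.lt_succ_of_le (Nat.find_min' hex hl)
    · exact ⟨0, fun h => absurd h hc, fun _ => rfl⟩
  choose t ht1 ht2 using hex
  refine ⟨{ entry := t, row_weak' := ?_, col_strict' := ?_, zeros' := fun h => ht2 _ _ h },
    fun k => ?_⟩
  · intro i j1 j2 hj hc
    have hc' := μ.up_left_mem le_rfl hj.le hc
    have := (ht1 i j1 hc' (t i j2 + 1)).2
      ((Y _).up_left_mem le_rfl hj.le ((ht1 i j2 hc _).1 (Nat.lt_succ_self _)))
    omega
  · intro i1 i2 j hi hc
    have hc' := μ.up_left_mem hi.le le_rfl hc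
    -- Column strictness is the condition `h2`: a box below row `i1` in `Y (k + 1)` forces the box
    -- of row `i1` in the same column into `Y k`.
    exact (ht1 i1 j hc' _).2 (rowLen_le_iff.1 (h2 _ i1) j
      ((Y _).up_left_mem hi le_rfl ((ht1 i2 j hc _).1 (Nat.lt_succ_self _))))
  · ext ⟨i, j⟩
    rw [YoungDiagram.mem_cells, YoungDiagram.mem_cells, mem_upTo]
    exact ⟨fun H => (ht1 i j H.1 k).1 H.2, fun H => ⟨hμ _ _ _ H, (ht1 i j (hμ _ _ _ H) k).2 H⟩⟩

/-- Outside this rectangle no letter is added to the row, so the lower index of the binomial is `0`.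
-/
theorem wt_eq_prod {q : ℝ} (hq : 0 < q) (T : SemistandardYoungTableau μ) {k r : ℕ}
    (hk : ∀ j, k ≤ j → content T j = 0) (hr : μ.rowLen r = 0) :
    wt q T = ∏ j ∈ Finset.range k, ∏ i ∈ Finset.range r, wtFactor q T i j := by
  rw [wt, finprod_eq_prod_of_mulSupport_subset (s := Finset.range r ×ˢ Finset.range k),
    Finset.prod_product_right]
  rintro ⟨i, j⟩ hij
  simp only [Finset.coe_product, Finset.coe_range, Set.mem_prod, Set.mem_Iio]
  by_contra hno
  apply hij
  have : (upTo T (j + 1)).rowLen i ≤ (upTo T j).rowLen i := by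
    rcases lt_or_ge i r with hi | hi
    · have hj : k ≤ j := by
        by_contra hj
        exact hno ⟨hi, not_le.1 hj⟩
      rw [upTo_eq_of_content hk hj, upTo_eq_of_content hk (hj.trans j.le_succ)]
    · have := rowLen_upTo_le T (j + 1) i
      rw [rowLen_eq_zero_of_le hr hi] at this
      omega
  simp only [wtFactor, Nat.sub_eq_zero_of_le this, qBinom_zero_right hq]

end Tableau

theorem nComp_eq_sum {α : ℕ →₀ ℕ} {k : ℕ} (hk : ∀ j, k ≤ j → α j = 0) :
    nComp α = ∑ j ∈ Finset.range k, (α j).choose 2 := by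
  refine Finsupp.sum_of_support_subset α (fun j hj => ?_) _ (by simp)
  by_contra h
  exact Finsupp.mem_support_iff.1 hj (hk j (by simpa using h))

theorem exists_forall_ge_eq_zero (α : ℕ →₀ ℕ) : ∃ k, ∀ j, k ≤ j → α j = 0 := by
  obtain ⟨k, hk⟩ := α.support.exists_nat_subset_range
  refine ⟨k, fun j hj => ?_⟩
  by_contra h
  have := Finset.mem_range.1 (hk (Finsupp.mem_support_iff.2 h))
  omega

/-! ### Counting strictly compatible chains of subspaces -/

section Chains

variable {K : Type*} [Field K] {V : Type*} [AddCommGroup V] [Module K V]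

/-- The chains of subspaces of types `Y 0, Y 1, …` which are strictly compatible with `N` and end
with `W` at position `k`. -/
def chains (N : Module.End K V) (Y : ℕ → YoungDiagram) (k : ℕ) (W : Submodule K V) :
    Set (ℕ → Submodule K V) :=
  {s | s 0 = ⊥ ∧ (∀ i, k ≤ i → s i = W) ∧
    ∀ i < k, s i ≤ s (i + 1) ∧ (s (i + 1)).map N ≤ s i ∧ KerDims N (s i) (Y i)}

theorem finite_chains [Finite K] [Module.Finite K V] (N : Module.End K V) (Y : ℕ → YoungDiagram)
    (k : ℕ) (W : Submodule K V) : (chains N Y k W).Finite := by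
  have : Finite V := Module.finite_of_finite K
  refine Set.Finite.of_injOn (f := fun s (i : Fin k) => s i) (t := Set.univ)
    (fun _ _ => Set.mem_univ _) ?_ (Set.toFinite _)
  intro s hs s' hs' h
  funext i
  rcases lt_or_ge i k with hi | hi
  · exact congrFun h ⟨i, hi⟩
  · rw [hs.2.1 i hi, hs'.2.1 i hi]

/-- Truncating a chain at position `k` is inverted by appending `W` after `W'`. -/
theorem ncard_chains_fiber (N : Module.End K V) (Y : ℕ → YoungDiagram) (k : ℕ)
    {W W' : Submodule K V} (h1 : W.map N ≤ W') (h2 : W' ≤ W) (h3 : KerDims N W' (Y k)) :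
    {s ∈ chains N Y (k + 1) W | s k = W'}.ncard = (chains N Y k W').ncard := by
  refine Set.ncard_congr (fun s _ i => s (min i k)) ?_ ?_ ?_
  · rintro s ⟨⟨hs0, -, hs⟩, hk⟩
    refine ⟨by simpa using hs0, fun i hi => by simpa [hi] using hk, fun i hi => ?_⟩
    beta_reduce
    rw [min_eq_left hi.le, min_eq_left (Nat.succ_le_of_lt hi)]
    exact hs i (by omega)
  · rintro s s' ⟨⟨-, hs, -⟩, -⟩ ⟨⟨-, hs', -⟩, -⟩ h
    funext i
    rcases le_or_gt i k with hi | hi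
    · simpa [hi] using congrFun h i
    · rw [hs i hi, hs' i hi]
  · rintro s ⟨hs0, hsk, hs⟩
    refine ⟨fun i => if i ≤ k then s i else W, ⟨⟨by simpa using hs0, fun i hi => ?_,
      fun i hi => ?_⟩, by simpa using hsk k le_rfl⟩, ?_⟩
    · exact if_neg (by omega)
    · rcases Nat.lt_or_eq_of_le (Nat.lt_succ_iff.1 hi) with hi' | rfl
      · beta_reduce
        rw [if_pos hi'.le, if_pos (by omega)]
        exact hs i hi'
      · beta_reduce
        rw [if_pos le_rfl, if_neg (by omega), hsk i le_rfl]
        exact ⟨h2, h1, h3⟩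
    · funext i
      beta_reduce
      rw [if_pos (min_le_right _ _)]
      rcases le_total i k with hi | hi
      · rw [min_eq_left hi]
      · rw [min_eq_right hi, hsk k le_rfl, hsk i hi]

/-- Induction over the penultimate space `W'`: the number of chains ending in `W'` is the same for
all admissible `W'`, and the powers of `q` telescope. -/
theorem ncard_chains_mul_pow [Finite K] [Module.Finite K V] {q : ℝ}
    (hq : q⁻¹ = (Nat.card K : ℝ)) {N : Module.End K V} (hN : IsNilpotent N)
    {Y : ℕ → YoungDiagram} (h0 : Y 0 = ⊥)
    (h1 : ∀ k i, (Y k).rowLen i ≤ (Y (k + 1)).rowLen i)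
    (h2 : ∀ k i, (Y (k + 1)).rowLen (i + 1) ≤ (Y k).rowLen i) {r : ℕ}
    (hr : ∀ k, (Y k).rowLen r = 0) (k : ℕ) {W : Submodule K V} (hW : KerDims N W (Y k))
    (hWN : W.map N ≤ W) :
    ((chains N Y k W).ncard : ℝ) * q ^ nPart (Y k) =
      q ^ (∑ j ∈ Finset.range k, ((Y (j + 1)).card - (Y j).card).choose 2) *
        ∏ j ∈ Finset.range k, ∏ i ∈ Finset.range r,
          qBinom q ((Y (j + 1)).rowLen i - (Y (j + 1)).rowLen (i + 1))
            ((Y (j + 1)).rowLen i - (Y j).rowLen i) := by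
  have : Finite V := Module.finite_of_finite K
  obtain ⟨hq0, -⟩ := lt_one_of_inv_eq_card hq
  induction k generalizing W with
  | zero =>
    have hW0 : W = ⊥ := by
      rw [← Submodule.finrank_eq_zero (R := K), hW.finrank_eq hN, h0]
      rfl
    have hs : chains N Y 0 W = {fun _ => ⊥} := by
      ext s
      rw [Set.mem_singleton_iff]
      constructor
      · rintro ⟨-, hs, -⟩
        funext i
        rw [hs i (Nat.zero_le i), hW0]
      · rintro rfl
        exact ⟨rfl, fun _ _ => hW0.symm, fun i hi => absurd hi (Nat.not_lt_zero i)⟩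
    rw [hs, nPart_eq_sum (hr 0), h0]
    have hb : ∀ i, (⊥ : YoungDiagram).rowLen i = 0 := fun i =>
      Nat.le_zero.1 (not_lt.1 fun h =>
        YoungDiagram.notMem_bot _ (YoungDiagram.mem_iff_lt_rowLen.2 h))
    simp [hb]
  | succ k ih =>
    set t := {W' : Submodule K V | W.map N ≤ W' ∧ W' ≤ W ∧ KerDims N W' (Y k)} with ht
    have hstep := hW.ncard_mul_pow hq hN hWN (h1 k) (h2 k) (hr (k + 1))
    have hsum := ncard_eq_sum_fiber (finite_chains N Y (k + 1) W) (Set.toFinite t)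
      (fun s => s k) fun s hs => by
        obtain ⟨-, hs2, hs3⟩ := hs
        obtain ⟨h3, h4, h5⟩ := hs3 k k.lt_succ_self
        rw [hs2 _ le_rfl] at h3 h4
        exact ⟨h4, h3, h5⟩
    have hsum' := congrArg (fun m : ℕ => (m : ℝ) * q ^ nPart (Y k)) hsum
    simp only [Nat.cast_sum, Finset.sum_mul] at hsum'
    rw [Finset.sum_congr rfl fun W' hW' => by
      obtain ⟨h3, h4, h5⟩ := (Set.Finite.mem_toFinset _).1 hW'
      rw [ncard_chains_fiber N Y k h3 h4 h5, ih h5 ((Submodule.map_mono h4).trans h3)],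
      Finset.sum_const, ← Set.ncard_eq_toFinset_card t, nsmul_eq_mul] at hsum'
    -- The extra factor `q ^ nPart (Y k)` is what the induction hypothesis absorbs and the one-step
    -- count returns.
    refine mul_right_cancel₀ (pow_ne_zero (nPart (Y k)) hq0.ne') ?_
    rw [mul_right_comm, hsum', mul_right_comm, hstep, Finset.prod_range_succ,
      Finset.sum_range_succ]
    ring

end Chains

/-! ### Counting strictly compatible partial flags -/

section PartialFlags

variable {K : Type*} [Field K] {n : ℕ}

theorem PartialFlag.space_injective :
    Function.Injective (PartialFlag.space : PartialFlag K n → _) := by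
  rintro ⟨s, _, _, _⟩ ⟨s', _, _, _⟩ h
  cases h
  rfl

theorem isJFTableau_iff {F : PartialFlag K n} {N : Module.End K (Fin n → K)} (hN : IsNilpotent N)
    (h : StrictlyCompatible F N) {μ : YoungDiagram} {T : SemistandardYoungTableau μ} :
    IsJFTableau h T ↔ ∀ i, KerDims N (F.space i) (upTo T i) :=
  forall_congr' fun i => isJF_restrict_iff hN (h.mapsTo i)

theorem space_eq_top_of_mem_Fl {F : PartialFlag K n} {α : ℕ →₀ ℕ} (hF : F ∈ Fl K n α) {k : ℕ}
    (hk : ∀ j, k ≤ j → α j = 0) {i : ℕ} (hi : k ≤ i) : F.space i = ⊤ := by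
  obtain ⟨m, hm⟩ := F.exhaustive
  have htop : F.space (max m i) = ⊤ := top_le_iff.1 (hm ▸ F.mono (le_max_left m i))
  rw [← htop]
  refine Submodule.eq_of_le_of_finrank_eq (F.mono (le_max_right m i)) ?_
  rw [hF i, hF (max m i)]
  refine Finset.sum_subset (Finset.range_mono (le_max_right m i)) fun j _ hj => hk j ?_
  have : i ≤ j := by simpa using hj
  omega

theorem finite_Fl [Finite K] (α : ℕ →₀ ℕ) : (Fl K n α).Finite := by
  obtain ⟨k, hk⟩ := exists_forall_ge_eq_zero α
  refine Set.Finite.of_injOn (f := fun F (i : Fin k) => F.space i) (t := Set.univ)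
    (fun _ _ => Set.mem_univ _) ?_ (Set.toFinite _)
  intro F hF F' hF' h
  refine PartialFlag.space_injective (funext fun i => ?_)
  rcases lt_or_ge i k with hi | hi
  · exact congrFun h ⟨i, hi⟩
  · rw [space_eq_top_of_mem_Fl hF hk hi, space_eq_top_of_mem_Fl hF' hk hi]

theorem PartialFlag.mem_Fl_iff_type_eq {F : PartialFlag K n} {α : ℕ →₀ ℕ} :
    F ∈ Fl K n α ↔ F.type = α := by
  have htype : ∀ i, F.type i = finrank K (F.space (i + 1)) - finrank K (F.space i) := fun _ => rfl
  constructor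
  · intro h
    ext i
    rw [htype, h, h, Finset.sum_range_succ, Nat.add_sub_cancel_left]
  · rintro rfl i
    induction i with
    | zero => simp [F.zero]
    | succ i ih =>
      rw [Finset.sum_range_succ, ← ih, htype]
      exact (Nat.add_sub_cancel' (finrank_mono (F.mono i.le_succ))).symm

variable {μ : YoungDiagram} {N : Module.End K (Fin n → K)}

/-- The dimension conditions of `Fl K n α` come for free: a space of type `upTo T i` has as many
dimensions as `T` has letters below `i`. -/
theorem ncard_isJFTableau (hN : IsNilpotent N) (hJF : IsJF N μ) {α : ℕ →₀ ℕ}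
    {T : SemistandardYoungTableau μ} (hT : T ∈ SSYT μ α) {k : ℕ} (hk : ∀ j, k ≤ j → α j = 0) :
    {F ∈ Fl K n α | ∃ h : StrictlyCompatible F N, IsJFTableau h T}.ncard =
      (chains N (upTo T) k ⊤).ncard := by
  obtain rfl : content T = α := hT
  refine Set.ncard_congr (fun F _ => F.space) ?_ ?_ ?_
  · rintro F ⟨hF, hc, hJ⟩
    rw [isJFTableau_iff hN] at hJ
    exact ⟨F.zero, fun i hi => space_eq_top_of_mem_Fl hF hk hi,
      fun i _ => ⟨F.mono i.le_succ, hc i, hJ i⟩⟩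
  · intro F F' _ _ h
    exact PartialFlag.space_injective h
  · rintro s ⟨hs0, hsk, hs⟩
    have hmono : Monotone s := monotone_nat_of_le_succ fun i => by
      rcases lt_or_ge i k with hi | hi
      · exact (hs i hi).1
      · rw [hsk i hi, hsk (i + 1) (by omega)]
    have hdims : ∀ i, KerDims N (s i) (upTo T i) := fun i => by
      rcases lt_or_ge i k with hi | hi
      · exact (hs i hi).2.2
      · rw [hsk i hi, upTo_eq_of_content hk hi]
        exact hJF.kerDims_top
    let F : PartialFlag K n :=
      { space := s, mono := hmono, zero := hs0, exhaustive := ⟨k, hsk k le_rfl⟩ }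
    have hF : StrictlyCompatible F N := fun i => by
      rcases lt_or_ge i k with hi | hi
      · exact (hs i hi).2.1
      · exact le_top.trans (hsk i hi).ge
    exact ⟨F, ⟨fun i => ((hdims i).finrank_eq hN).trans (card_upTo T i), hF,
      (isJFTableau_iff hN hF).2 hdims⟩, rfl⟩

theorem wt_eq_zpow_mul_ncard [Finite K] {q : ℝ} (hq : q⁻¹ = (Nat.card K : ℝ))
    (hN : IsNilpotent N) (hJF : IsJF N μ) {α : ℕ →₀ ℕ}
    {T : SemistandardYoungTableau μ} (hT : T ∈ SSYT μ α) :
    wt q T = q ^ ((nPart μ : ℤ) - (nComp α : ℤ)) *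
      ({F ∈ Fl K n α | ∃ h : StrictlyCompatible F N, IsJFTableau h T}.ncard : ℝ) := by
  obtain ⟨hq0, -⟩ := lt_one_of_inv_eq_card hq
  obtain rfl : content T = α := hT
  obtain ⟨k, hk⟩ := exists_forall_ge_eq_zero (content T)
  have hr : μ.rowLen (μ.colLen 0) = 0 := rowLen_eq_zero_iff.2 le_rfl
  have htop : upTo T k = μ := upTo_eq_of_content hk le_rfl
  have key := ncard_chains_mul_pow hq hN (upTo_zero T)
    (fun k => rowLen_upTo_mono T k.le_succ) (rowLen_succ_upTo_succ_le T)
    (fun k => Nat.le_zero.1 (hr ▸ rowLen_upTo_le T k _)) k (W := ⊤)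
    (by rw [htop]; exact hJF.kerDims_top) le_top
  have hcard : ∀ j, (upTo T (j + 1)).card - (upTo T j).card = content T j := fun j => by
    rw [card_upTo, card_upTo, Finset.sum_range_succ, Nat.add_sub_cancel_left]
  simp only [hcard] at key
  rw [← ncard_isJFTableau hN hJF rfl hk, htop, ← nComp_eq_sum hk] at key
  have hwt := wt_eq_prod hq0 T hk hr
  simp only [wtFactor] at hwt
  rw [← hwt] at key
  rw [zpow_sub₀ hq0.ne', zpow_natCast, zpow_natCast, div_mul_eq_mul_div,
    eq_div_iff (pow_ne_zero _ hq0.ne'), mul_comm (wt q T), ← key, mul_comm]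

/-- Strict compatibility gives `N F_{i+1} ≤ F_i ≤ F_{i+1}`, so consecutive Jordan types interlace
and assemble into a tableau. -/
theorem exists_isJFTableau (hN : IsNilpotent N) (hJF : IsJF N μ) {α : ℕ →₀ ℕ}
    {F : PartialFlag K n} (hF : F ∈ Fl K n α) (hc : StrictlyCompatible F N) :
    ∃ T ∈ SSYT μ α, IsJFTableau hc T := by
  choose Y hY using fun i => exists_isJF_restrict hN (hc.mapsTo i)
  replace hY : ∀ i, KerDims N (F.space i) (Y i) := fun i => (isJF_restrict_iff hN _).1 (hY i)
  obtain ⟨m, hm⟩ := F.exhaustive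
  have h0 : Y 0 = ⊥ := by
    have h1 := (hY 0).finrank_eq hN
    rw [F.zero, finrank_bot] at h1
    ext c
    rw [Finset.card_eq_zero.1 h1.symm]
    simp
  obtain ⟨T, hT⟩ := exists_tableau (μ := μ) (Y := Y) (m := m) h0
    (fun k i => ((hY (k + 1)).interlacing (hY k) (hc k) (F.mono k.le_succ) i).1)
    (fun k i => ((hY (k + 1)).interlacing (hY k) (hc k) (F.mono k.le_succ) i).2)
    (fun k hk => (hY k).unique (top_le_iff.1 (hm ▸ F.mono hk : ⊤ ≤ F.space k) ▸ hJF.kerDims_top))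
  refine ⟨T, ?_, (isJFTableau_iff hN hc).2 fun i => by rw [hT]; exact hY i⟩
  have hsum : ∀ i, ∑ j ∈ Finset.range i, content T j = ∑ j ∈ Finset.range i, α j := fun i => by
    rw [← card_upTo, ← hF i, (hY i).finrank_eq hN, hT]
  refine Finsupp.ext fun i => ?_
  have h1 := hsum (i + 1)
  rw [Finset.sum_range_succ, Finset.sum_range_succ, hsum i] at h1
  omega

theorem IsJFTableau.unique (hN : IsNilpotent N) {F : PartialFlag K n}
    {hc : StrictlyCompatible F N} {T T' : SemistandardYoungTableau μ} (h : IsJFTableau hc T)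
    (h' : IsJFTableau hc T') : T = T' :=
  upTo_injective fun i =>
    ((isJFTableau_iff hN hc).1 h i).unique ((isJFTableau_iff hN hc).1 h' i)

/-- The flags are partitioned by their unique tableau, and each class is counted by
`wt_eq_zpow_mul_ncard`. -/
theorem coeff_whittaker [Finite K] {q : ℝ} (hq : q⁻¹ = (Nat.card K : ℝ))
    (hN : IsNilpotent N) (hJF : IsJF N μ) (α : ℕ →₀ ℕ) :
    MvPowerSeries.coeff α (whittaker q μ) = q ^ ((nPart μ : ℤ) - (nComp α : ℤ)) *
      ({F ∈ Fl K n α | StrictlyCompatible F N}.ncard : ℝ) := by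
  classical
  choose! f hf using fun (F : PartialFlag K n) (h : F ∈ Fl K n α ∧ StrictlyCompatible F N) =>
    exists_isJFTableau hN hJF h.1 h.2
  have hsum := ncard_eq_sum_fiber (s := {F ∈ Fl K n α | StrictlyCompatible F N})
    ((finite_Fl α).subset fun F hF => hF.1) (finite_SSYT μ α) f fun F hF => (hf F hF).1
  rw [hsum, Nat.cast_sum, Finset.mul_sum]
  refine (finsum_mem_eq_finite_toFinset_sum _ (finite_SSYT μ α)).trans
    (Finset.sum_congr rfl fun T hT => ?_)
  rw [wt_eq_zpow_mul_ncard hq hN hJF ((Set.Finite.mem_toFinset _).1 hT)]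
  congr 3
  ext F
  constructor
  · rintro ⟨hF, hc, hJ⟩
    exact ⟨⟨hF, hc⟩, (hf F ⟨hF, hc⟩).2.unique hN hJ⟩
  · rintro ⟨⟨hF, hc⟩, rfl⟩
    exact ⟨hF, hc, (hf F ⟨hF, hc⟩).2⟩

end PartialFlags

/-! ### The generating function of partial flags -/

theorem prod_C_mul_X_pow (α : ℕ →₀ ℕ) (g : ℕ → ℝ) :
    (α.prod fun i d => MvPowerSeries.C (g d) * (MvPowerSeries.X i : MvPowerSeries ℕ ℝ) ^ d) =
      MvPowerSeries.monomial α (α.prod fun _ d => g d) := by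
  rw [MvPowerSeries.monomial_eq', Finsupp.prod_mul, Finsupp.prod, Finsupp.prod, Finsupp.prod, map_prod]

/-- Convergence is coefficientwise: only the finitely many flags of type `α` contribute to `x^α`,
each with `(q ^ nComp α)⁻¹`. -/
theorem hasSum_partialFlags {K : Type*} [Field K] [Finite K] {n : ℕ} {q : ℝ}
    (hq : q⁻¹ = (Nat.card K : ℝ)) {μ : YoungDiagram} {N : Module.End K (Fin n → K)}
    (hN : IsNilpotent N) (hJF : IsJF N μ) :
    HasSum (fun F : {F : PartialFlag K n // StrictlyCompatible F N} =>
        F.1.type.prod fun i d =>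
          MvPowerSeries.C ((q ^ d.choose 2)⁻¹) * (MvPowerSeries.X i : MvPowerSeries ℕ ℝ) ^ d)
      (MvPowerSeries.C (q ^ nPart μ)⁻¹ * whittaker q μ) := by
  classical
  obtain ⟨hq0, -⟩ := lt_one_of_inv_eq_card hq
  simp only [prod_C_mul_X_pow _ fun d => (q ^ d.choose 2)⁻¹]
  have hprod : ∀ α : ℕ →₀ ℕ, (α.prod fun _ d => (q ^ d.choose 2)⁻¹) = (q ^ nComp α)⁻¹ :=
    fun α => by
      rw [nComp, Finsupp.prod, Finsupp.sum, Finset.prod_inv_distrib, Finset.prod_pow_eq_pow_sum]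
  simp only [hprod]
  refine (MvPowerSeries.WithPiTopology.tendsto_iff_coeff_tendsto _ _ _).2 fun α => ?_
  have hfin : {F : {F : PartialFlag K n // StrictlyCompatible F N} | F.1 ∈ Fl K n α}.Finite :=
    (finite_Fl α).preimage Subtype.val_injective.injOn
  have hcard : {F ∈ Fl K n α | StrictlyCompatible F N}.ncard = hfin.toFinset.card := by
    rw [← Set.ncard_eq_toFinset_card _ hfin, ← Set.ncard_image_of_injective _ Subtype.val_injective]
    congr 1
    ext F
    simp only [Set.mem_image, Set.mem_ofPred_eq, Subtype.exists, exists_and_right, exists_eq_right]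
    exact ⟨fun h => ⟨h.2, h.1⟩, fun ⟨h1, h2⟩ => ⟨h2, h1⟩⟩
  have h := hasSum_sum_of_ne_finset_zero (L := SummationFilter.unconditional _)
    (s := hfin.toFinset) (f := fun F : {F : PartialFlag K n // StrictlyCompatible F N} =>
      MvPowerSeries.coeff α (MvPowerSeries.monomial F.1.type (q ^ nComp F.1.type)⁻¹))
    fun F hF => MvPowerSeries.coeff_monomial_ne (fun hα => hF ((Set.Finite.mem_toFinset _).2
      (PartialFlag.mem_Fl_iff_type_eq.2 hα.symm))) _
  rw [Finset.sum_congr rfl (g := fun _ => (q ^ nComp α)⁻¹) fun F hF => by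
    rw [PartialFlag.mem_Fl_iff_type_eq.1 ((Set.Finite.mem_toFinset hfin).1 hF),
      MvPowerSeries.coeff_monomial_same], Finset.sum_const, nsmul_eq_mul] at h
  rw [MvPowerSeries.coeff_C_mul, coeff_whittaker hq hN hJF, hcard, zpow_sub₀ hq0.ne',
    zpow_natCast, zpow_natCast, div_mul_eq_mul_div, mul_comm (q ^ nPart μ), mul_div_assoc,
    mul_comm, mul_assoc, div_mul_eq_mul_div, mul_inv_cancel₀ (pow_ne_zero _ hq0.ne'), one_div]
  simpa only [HasSum, map_sum] using h

end QWhittaker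

theorem theorem4p7 {K : Type*} [Field K] [Finite K] (q : ℝ) (hq : q⁻¹ = (Nat.card K : ℝ))
    (n : ℕ) (μ : YoungDiagram) (hμ : μ.card = n)
    (N : Module.End K (Fin n → K)) (hN : IsNilpotent N) (hJF : QWhittaker.IsJF N μ) :
    (∀ α : ℕ →₀ ℕ, α.degree = n → ∀ T ∈ QWhittaker.SSYT μ α,
      QWhittaker.wt q T = q ^ ((QWhittaker.nPart μ : ℤ) - (QWhittaker.nComp α : ℤ)) *
        (Set.ncard {F ∈ QWhittaker.Fl K n α |
          ∃ h : QWhittaker.StrictlyCompatible F N, QWhittaker.IsJFTableau h T} : ℝ)) ∧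
    (∀ α : ℕ →₀ ℕ, α.degree = n →
      MvPowerSeries.coeff α (QWhittaker.whittaker q μ) =
        q ^ ((QWhittaker.nPart μ : ℤ) - (QWhittaker.nComp α : ℤ)) *
          (Set.ncard {F ∈ QWhittaker.Fl K n α | QWhittaker.StrictlyCompatible F N} : ℝ)) ∧
    (Summable (fun F : {F : QWhittaker.PartialFlag K n // QWhittaker.StrictlyCompatible F N} =>
        F.1.type.prod fun i d =>
          MvPowerSeries.C ((q ^ d.choose 2)⁻¹) * (MvPowerSeries.X i : MvPowerSeries ℕ ℝ) ^ d) ∧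
      QWhittaker.whittaker q μ =
        MvPowerSeries.C (q ^ QWhittaker.nPart μ) *
          ∑' F : {F : QWhittaker.PartialFlag K n // QWhittaker.StrictlyCompatible F N},
            F.1.type.prod fun i d =>
              MvPowerSeries.C ((q ^ d.choose 2)⁻¹) *
                (MvPowerSeries.X i : MvPowerSeries ℕ ℝ) ^ d) := by
  obtain ⟨hq0, -⟩ := QWhittaker.lt_one_of_inv_eq_card hq
  have hsum := QWhittaker.hasSum_partialFlags hq hN hJF
  refine ⟨fun α _ T hT => QWhittaker.wt_eq_zpow_mul_ncard hq hN hJF hT,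
    fun α _ => QWhittaker.coeff_whittaker hq hN hJF α, hsum.summable, ?_⟩
  rw [hsum.tsum_eq, ← mul_assoc, ← map_mul, mul_inv_cancel₀ (pow_ne_zero _ hq0.ne'), map_one,
    one_mul]
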